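/- Let $r\ge 1$, $q=2^r$ and $n\ge 3$. For $a\in\mathbb F_{q^n}$ put $$T_1(a)=\sum_{0\le i\le n-1}a^{q^i},\qquad T_2(a)=\sum_{0\le i<j\le n-1}a^{q^i+q^j},\qquad T_3(a)=\sum_{0\le i<j<k\le n-1}a^{q^i+q^j+q^k},$$ and let $F_q(n,0,0,0)$ be the number of $a\in\mathbb F_{q^n}$ with $T_1(a)=T_2(a)=T_3(a)=0$. Let $\omega_k=e^{2\pi i/k}$. If $r$ is odd, then $$\begin{aligned}F_q(n,0,0,0)=q^{n-3}-q^{n/2-3}\Big(&\tfrac{q(q-1)(q-2)}{8}\big(1^n+(-1)^n\big)+\tfrac{q(q-1)(q+2)}{8}\big(i^n+(-i)^n\big)\\ &+\tfrac{(q-1)(q+1)(q-\sqrt{2q})}{12}\big(\omega_{24}^{n}+\omega_{24}^{7n}+\omega_{24}^{17n}+\omega_{24}^{23n}\big)\\ &+\tfrac{(q-1)(q+1)(q+\sqrt{2q})}{12}\big(\omega_{24}^{5n}+\omega_{24}^{11n}+\omega_{24}^{13n}+\omega_{24}^{19n}\big)\\ &+\tfrac{(q-1)(q-\sqrt{2q})(5q+\sqrt{2q}+4)}{24}\big(\omega_8^{n}+\omega_8^{7n}\big)\\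 &+\tfrac{(q-1)(q+\sqrt{2q})(5q-\sqrt{2q}+4)}{24}\big(\omega_8^{3n}+\omega_8^{5n}\big)\Big).\end{aligned}$$ If $r$ is even, then $$\begin{aligned}F_q(n,0,0,0)=q^{n-3}-q^{n/2-3}\Big(&\tfrac{(q-1)(q-2\sqrt q)(5q+2\sqrt q+4)}{24}\,1^n+\tfrac{(q-1)(q+2\sqrt q)(5q-2\sqrt q+4)}{24}(-1)^n\\ &+\tfrac{q(q-1)(5q+4)}{24}\big(i^n+(-i)^n\big)+\tfrac{q^2(q-1)}{8}\big(\omega_8^{n}+\omega_8^{7n}+\omega_8^{3n}+\omega_8^{5n}\big)\\ &+\tfrac{q(q-1)^2}{12}\big(\omega_{12}^{n}+\omega_{12}^{5n}+\omega_{12}^{7n}+\omega_{12}^{11n}\big)\\ &+\tfrac{(q-1)(q-\sqrt q)(q-\sqrt q+2)}{12}\big(\omega_6^{n}+\omega_6^{5n}\big)\\ &+\tfrac{(q-1)(q+\sqrt q)(q+\sqrt q+2)}{12}\big(\omega_6^{2n}+\omega_6^{4n}\big)\Big).\end{aligned}$$ Equivalently, $F_q(n,0,0,0)-q^{n-3}$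 has the following value, depending on $n$ modulo $24$. For $r$ odd: - $n\equiv 0$: $-(q-1)(2q+1)q^{n/2-2}$; - $n\equiv 1,7,17,23$: $(q^2-1)q^{(n-1)/2-2}$; - $n\equiv 5,11,13,19$: $-(q^2-1)q^{(n-1)/2-2}$; - $n\equiv 2,6,10,14,18,22$: $(q-1)q^{n/2-2}$; - $n\equiv 8,16$: $-(q-1)q^{n/2-1}$; - $n\equiv 12$: $(q^2-1)q^{n/2-2}$; - $n\equiv 3,4,9,15,20,21$: $0$. For $r$ even: - $n\equiv 0$: $-(q-1)(2q+1)q^{n/2-2}$; - $n\equiv 1,5,7,11,13,17,19,23$: $(q^2-1)q^{(n-1)/2-2}$; - $n\equiv 2,10,14,22$: $(q-1)q^{n/2-2}$; - $n\equiv 6,18$: $-(q-1)q^{n/2-2}$; - $n\equiv 8,16$: $-(q-1)q^{n/2-1}$; - $n\equiv 12$: $-(q^2-1)q^{n/2-2}$; - $n\equiv 3,4,9,15,20,21$: $0$. In particular $q^{-n/2}\big(F_q(n,0,0,0)-q^{n-3}\big)$ is periodic in $n\ge 3$ with period $24$: its values at $n$ and $n+24$ agree. -/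

import Mathlib

noncomputable section

/-- The first trace `∑_{0 ≤ i ≤ n-1} a^{q^i}`. -/
def T1 {L : Type*} [Field L] (q n : ℕ) (a : L) : L :=
  ∑ i ∈ Finset.range n, a ^ q ^ i

/-- The second trace `∑_{0 ≤ i < j ≤ n-1} a^{q^i + q^j}`. -/
def T2 {L : Type*} [Field L] (q n : ℕ) (a : L) : L :=
  ∑ j ∈ Finset.range n, ∑ i ∈ Finset.range j, a ^ (q ^ i + q ^ j)

/-- The third trace `∑_{0 ≤ i < j < k ≤ n-1} a^{q^i + q^j + q^k}`. -/
def T3 {L : Type*} [Field L] (q n : ℕ) (a : L) : L :=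
  ∑ k ∈ Finset.range n, ∑ j ∈ Finset.range k, ∑ i ∈ Finset.range j,
    a ^ (q ^ i + q ^ j + q ^ k)

/-- For an extension `L / K` of finite fields with `#K = q` and `[L : K] = n`, the number
`F_q(n, t₁, t₂, t₃)` of elements of `L` with first three traces `t₁, t₂, t₃ ∈ K`. -/
def traceCount (K L : Type*) [Field K] [Field L] [Algebra K L] (t₁ t₂ t₃ : K) : ℕ :=
  Nat.card {a : L //
    T1 (Nat.card K) (Module.finrank K L) a = algebraMap K L t₁ ∧
    T2 (Nat.card K) (Module.finrank K L) a = algebraMap K L t₂ ∧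
    T3 (Nat.card K) (Module.finrank K L) a = algebraMap K L t₃}

/-- The primitive complex root of unity `ω_k = e^{2πi/k}`. -/
def rootU (k : ℕ) : ℂ := Complex.exp (2 * (Real.pi : ℂ) * Complex.I / (k : ℂ))

/-- The combination of roots of unity in the formula for `q = 2^r` with `r` odd. -/
def fourierOdd (q n : ℕ) : ℂ :=
  let Q : ℂ := (q : ℂ)
  let s : ℂ := ((Real.sqrt (2 * (q : ℝ)) : ℝ) : ℂ)
  Q * (Q - 1) * (Q - 2) / 8 * (1 ^ n + (-1) ^ n)
  + Q * (Q - 1) * (Q + 2) / 8 * (Complex.I ^ n + (-Complex.I) ^ n)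
  + (Q - 1) * (Q + 1) * (Q - s) / 12 *
      (rootU 24 ^ n + rootU 24 ^ (7 * n) + rootU 24 ^ (17 * n) + rootU 24 ^ (23 * n))
  + (Q - 1) * (Q + 1) * (Q + s) / 12 *
      (rootU 24 ^ (5 * n) + rootU 24 ^ (11 * n) + rootU 24 ^ (13 * n) + rootU 24 ^ (19 * n))
  + (Q - 1) * (Q - s) * (5 * Q + s + 4) / 24 * (rootU 8 ^ n + rootU 8 ^ (7 * n))
  + (Q - 1) * (Q + s) * (5 * Q - s + 4) / 24 * (rootU 8 ^ (3 * n) + rootU 8 ^ (5 * n))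

/-- The combination of roots of unity in the formula for `q = 2^r` with `r` even. -/
def fourierEven (q n : ℕ) : ℂ :=
  let Q : ℂ := (q : ℂ)
  let s : ℂ := ((Real.sqrt (q : ℝ) : ℝ) : ℂ)
  (Q - 1) * (Q - 2 * s) * (5 * Q + 2 * s + 4) / 24 * 1 ^ n
  + (Q - 1) * (Q + 2 * s) * (5 * Q - 2 * s + 4) / 24 * (-1) ^ n
  + Q * (Q - 1) * (5 * Q + 4) / 24 * (Complex.I ^ n + (-Complex.I) ^ n)
  + Q ^ 2 * (Q - 1) / 8 *
      (rootU 8 ^ n + rootU 8 ^ (7 * n) + rootU 8 ^ (3 * n) + rootU 8 ^ (5 * n))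
  + Q * (Q - 1) ^ 2 / 12 *
      (rootU 12 ^ n + rootU 12 ^ (5 * n) + rootU 12 ^ (7 * n) + rootU 12 ^ (11 * n))
  + (Q - 1) * (Q - s) * (Q - s + 2) / 12 * (rootU 6 ^ n + rootU 6 ^ (5 * n))
  + (Q - 1) * (Q + s) * (Q + s + 2) / 12 * (rootU 6 ^ (2 * n) + rootU 6 ^ (4 * n))

/-- The tabulated value of `F_q(n,0,0,0) - q^{n-3}` for `q = 2^r` with `r` odd, by `n mod 24`. -/
def tableOdd (q n : ℕ) : ℝ :=
  let Q : ℝ := (q : ℝ)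
  let N : ℝ := (n : ℝ)
  match n % 24 with
  | 0 => -((Q - 1) * (2 * Q + 1) * Q ^ (N / 2 - 2))
  | 1 | 7 | 17 | 23 => (Q ^ 2 - 1) * Q ^ ((N - 1) / 2 - 2)
  | 5 | 11 | 13 | 19 => -((Q ^ 2 - 1) * Q ^ ((N - 1) / 2 - 2))
  | 2 | 6 | 10 | 14 | 18 | 22 => (Q - 1) * Q ^ (N / 2 - 2)
  | 8 | 16 => -((Q - 1) * Q ^ (N / 2 - 1))
  | 12 => (Q ^ 2 - 1) * Q ^ (N / 2 - 2)
  | _ => 0 -- residues 3, 4, 9, 15, 20, 21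

/-- The tabulated value of `F_q(n,0,0,0) - q^{n-3}` for `q = 2^r` with `r` even, by `n mod 24`. -/
def tableEven (q n : ℕ) : ℝ :=
  let Q : ℝ := (q : ℝ)
  let N : ℝ := (n : ℝ)
  match n % 24 with
  | 0 => -((Q - 1) * (2 * Q + 1) * Q ^ (N / 2 - 2))
  | 1 | 5 | 7 | 11 | 13 | 17 | 19 | 23 => (Q ^ 2 - 1) * Q ^ ((N - 1) / 2 - 2)
  | 2 | 10 | 14 | 22 => (Q - 1) * Q ^ (N / 2 - 2)
  | 6 | 18 => -((Q - 1) * Q ^ (N / 2 - 2))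
  | 8 | 16 => -((Q - 1) * Q ^ (N / 2 - 1))
  | 12 => -((Q ^ 2 - 1) * Q ^ (N / 2 - 2))
  | _ => 0 -- residues 3, 4, 9, 15, 20, 21

end

/-! Reversing a monic polynomial over K = F_q and reducing modulo t⁴ turns multiplication into the
law of a group G of order q³, the truncated units 1 + c₁t + c₂t² + c₃t³. The three traces of a are
the coordinates of the class of its characteristic polynomial, so orthogonality of characters on G
(`card_mul_traceCount`) writes q³·F as a sum over characters χ of the sums of χ over L. Grouping
elements by minimal polynomial (`sum_ofElement`) identifies each inner sum with the n-th power sum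
of the L-series Σ χ(f) T^{deg f}, and `newton_identity` computes it from the coefficients. The
trivial character gives q^n; for every other χ the series is a polynomial 1 + c₁T + c₂T².

Characters are grouped by their restriction (u, v) ↦ (-1)^{Tr(mu + lv)} to 1 + ut² + vt³ (`fiber`).
If l ≠ 0, then c₂ is q times a fourth root of unity, and squaring the Gauss sum c₁ gives c₁² = R c₂
(`sq_monicSum_one`), where R is 0 or the order M of the radical of an alternating form, and M is 1,
2 or 4 (`card_rad`). If l = 0 and m ≠ 0, then c₂ = 0 and c₁² is q times a fourth root of unity. All
nonzero inverse roots are therefore √q times 24th roots of unity, which is the source of the period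
24.

Averaging over a fiber leaves only M and the sign (-1)^{Tr(m³/l²)}. Since c₁ is a Gaussian integer
whose square is a power of two times a fourth root of unity, `sq_eq_neg_one_pow` shows that this
sign tells whether M = 2. This fact and two elementary counts give the distribution of M (`sum_rad`,
`sum_rad_zero_of_odd`, `sum_rad_zero_of_even`). What remains is a comparison over the residues of n
modulo 24. -/

noncomputable section
open Polynomial

/-! ### The group of truncated units and reversals of monic polynomials -/

/-- The group of truncated polynomials `1 + c₁ t + c₂ t² + c₃ t³` modulo `t⁴`, written
additively. -/
@[ext] structure TruncUnit (R : Type*) where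
  c₁ : R
  c₂ : R
  c₃ : R

namespace TruncUnit

section CommRing
variable {R S : Type*} [CommRing R] [CommRing S]

instance : Zero (TruncUnit R) := ⟨⟨0, 0, 0⟩⟩
instance : Add (TruncUnit R) :=
  ⟨fun x y => ⟨x.c₁ + y.c₁, x.c₂ + y.c₂ + x.c₁ * y.c₁, x.c₃ + y.c₃ + x.c₁ * y.c₂ + x.c₂ * y.c₁⟩⟩
instance : Neg (TruncUnit R) :=
  ⟨fun x => ⟨-x.c₁, x.c₁ ^ 2 - x.c₂, 2 * x.c₁ * x.c₂ - x.c₁ ^ 3 - x.c₃⟩⟩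

@[simp] theorem zero_c₁ : (0 : TruncUnit R).c₁ = 0 := rfl
@[simp] theorem zero_c₂ : (0 : TruncUnit R).c₂ = 0 := rfl
@[simp] theorem zero_c₃ : (0 : TruncUnit R).c₃ = 0 := rfl
@[simp] theorem add_c₁ (x y : TruncUnit R) : (x + y).c₁ = x.c₁ + y.c₁ := rfl
@[simp] theorem add_c₂ (x y : TruncUnit R) : (x + y).c₂ = x.c₂ + y.c₂ + x.c₁ * y.c₁ := rfl
@[simp] theorem add_c₃ (x y : TruncUnit R) :
    (x + y).c₃ = x.c₃ + y.c₃ + x.c₁ * y.c₂ + x.c₂ * y.c₁ := rfl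
@[simp] theorem neg_c₁ (x : TruncUnit R) : (-x).c₁ = -x.c₁ := rfl
@[simp] theorem neg_c₂ (x : TruncUnit R) : (-x).c₂ = x.c₁ ^ 2 - x.c₂ := rfl
@[simp] theorem neg_c₃ (x : TruncUnit R) :
    (-x).c₃ = 2 * x.c₁ * x.c₂ - x.c₁ ^ 3 - x.c₃ := rfl

instance : AddCommGroup (TruncUnit R) where
  add_assoc x y z := by ext <;> simp <;> ring
  zero_add x := by ext <;> simp
  add_zero x := by ext <;> simp
  nsmul := nsmulRec
  zsmul := zsmulRec
  neg_add_cancel x := by ext <;> simp <;> ring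
  add_comm x y := by ext <;> simp <;> ring

/-- The underlying triple of coefficients. -/
def equivProd (R : Type*) : TruncUnit R ≃ R × R × R where
  toFun x := (x.c₁, x.c₂, x.c₃)
  invFun y := ⟨y.1, y.2.1, y.2.2⟩

instance {R : Type*} [Finite R] : Finite (TruncUnit R) := Finite.of_equiv _ (equivProd R).symm
instance {R : Type*} [Fintype R] : Fintype (TruncUnit R) := Fintype.ofEquiv _ (equivProd R).symm

theorem card_eq {R : Type*} [Fintype R] :
    Fintype.card (TruncUnit R) = Fintype.card R ^ 3 := by
  rw [Fintype.card_congr (equivProd R)]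
  simp only [Fintype.card_prod]
  ring

/-- Functoriality in the coefficient ring. -/
def map (φ : R →+* S) : TruncUnit R →+ TruncUnit S where
  toFun x := ⟨φ x.c₁, φ x.c₂, φ x.c₃⟩
  map_zero' := by ext <;> simp
  map_add' x y := by ext <;> simp

theorem map_injective {φ : R →+* S} (hφ : Function.Injective φ) :
    Function.Injective (map φ) := by
  intro x y h
  simp only [map, AddMonoidHom.coe_mk, ZeroHom.coe_mk, TruncUnit.mk.injEq] at h
  ext
  exacts [hφ h.1, hφ h.2.1, hφ h.2.2]

theorem add_mk_zero (x : TruncUnit R) (c : R) :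
    x + ⟨0, 0, c⟩ = ⟨x.c₁, x.c₂, x.c₃ + c⟩ := by ext <;> simp

theorem add_mk_zero' (x : TruncUnit R) (u v : R) :
    x + ⟨0, u, v⟩ = ⟨x.c₁, x.c₂ + u, x.c₃ + v + x.c₁ * u⟩ := by ext <;> simp

/-- The class modulo `t⁴` of the reversal of a polynomial. -/
def ofPoly (p : R[X]) : TruncUnit R :=
  ⟨p.reverse.coeff 1, p.reverse.coeff 2, p.reverse.coeff 3⟩

theorem ofPoly_one : ofPoly (1 : R[X]) = 0 := by
  have h : (1 : R[X]).reverse = 1 := by simpa using Polynomial.reverse_C (1 : R)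
  ext <;> simp [ofPoly, h, Polynomial.coeff_one]

theorem ofPoly_X_sub_C [Nontrivial R] (a : R) : ofPoly (X - C a) = ⟨-a, 0, 0⟩ := by
  have h : (X - C a : R[X]).reverse = 1 - C a * X := by
    ext k
    rw [coeff_reverse, natDegree_X_sub_C]
    rcases k with _ | _ | k
    · rw [revAt_le (by simp)]; simp
    · rw [revAt_le (by simp)]; simp [coeff_one]
    · rw [revAt_eq_self_of_lt (by omega)]; simp [coeff_X, coeff_one]
  ext <;> simp [ofPoly, h, Polynomial.coeff_one]

theorem ofPoly_coeff {p : R[X]} {k : ℕ} (hk : k ≤ p.natDegree) :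
    p.reverse.coeff k = p.coeff (p.natDegree - k) := by
  rw [coeff_reverse, revAt_le hk]

end CommRing

section Field
variable {K L : Type*} [Field K] [Field L]

/-- Reversal is multiplicative over a domain, and the reversal of a monic polynomial has constant
term 1; the law of `TruncUnit` is multiplication of such series modulo t⁴. -/
theorem ofPoly_mul {p q : K[X]} (hp : p.Monic) (hq : q.Monic) :
    ofPoly (p * q) = ofPoly p + ofPoly q := by
  have hp0 : p.reverse.coeff 0 = 1 := by rw [coeff_zero_reverse]; exact hp
  have hq0 : q.reverse.coeff 0 = 1 := by rw [coeff_zero_reverse]; exact hq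
  ext <;> simp [ofPoly, reverse_mul_of_domain, coeff_mul, Finset.Nat.antidiagonal_succ,
    hp0, hq0] <;> ring

theorem ofPoly_prod {ι : Type*} (s : Finset ι) (f : ι → K[X]) (hf : ∀ i ∈ s, (f i).Monic) :
    ofPoly (∏ i ∈ s, f i) = ∑ i ∈ s, ofPoly (f i) := by
  classical
  induction s using Finset.induction_on with
  | empty => simpa using ofPoly_one
  | insert i s hi ih =>
    rw [Finset.prod_insert hi, Finset.sum_insert hi,
      ofPoly_mul (hf i (by simp)) (monic_prod_of_monic _ _ fun j hj => hf j (by simp [hj])),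
      ih fun j hj => hf j (by simp [hj])]

theorem ofPoly_map (φ : K →+* L) (p : K[X]) : ofPoly (p.map φ) = map φ (ofPoly p) := by
  have h (k : ℕ) : (p.map φ).reverse.coeff k = φ (p.reverse.coeff k) := by
    rw [coeff_reverse, coeff_reverse, natDegree_map, coeff_map]
  simp [ofPoly, map, h]

/-- The three traces are the coefficients of `∏ (1 + a^{q^i} t)`. -/
theorem sum_frobenius_eq (q n : ℕ) (a : L) :
    ∑ i ∈ Finset.range n, (⟨a ^ q ^ i, 0, 0⟩ : TruncUnit L) = ⟨T1 q n a, T2 q n a, T3 q n a⟩ := by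
  induction n with
  | zero => ext <;> simp [T1, T2, T3]
  | succ n ih =>
    rw [Finset.sum_range_succ, ih]
    ext
    · simp [T1, Finset.sum_range_succ]
    · simp [T1, T2, Finset.sum_range_succ, pow_add, Finset.sum_mul]
    · simp [T2, T3, Finset.sum_range_succ, pow_add, Finset.sum_mul]

end Field

/-! ### Newton's identities for multiplicative functions on monic polynomials -/

section Newton
variable (K : Type*) [Field K] [Finite K]

theorem finite_monic (n : ℕ) : {p : K[X] | p.Monic ∧ p.natDegree = n}.Finite := by
  have : Finite (degreeLT K n) := Finite.of_equiv _ (degreeLTEquiv K n).symm.toEquiv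
  exact Set.finite_coe_iff.mp (Finite.of_equiv _ (monicEquivDegreeLT (R := K) n).symm)

/-- The monic polynomials of degree `n` over a finite field. -/
def monics (n : ℕ) : Finset K[X] := (finite_monic K n).toFinset

variable {K}

@[simp] theorem mem_monics {n : ℕ} {p : K[X]} : p ∈ monics K n ↔ p.Monic ∧ p.natDegree = n := by
  simp [monics]

open Classical in
variable (K) in
/-- The monic irreducible polynomials of degree at most `n`. -/
def primesLE (n : ℕ) : Finset K[X] :=
  ((Finset.range (n + 1)).biUnion fun k => monics K k).filter Irreducible

@[simp] theorem mem_primesLE {n : ℕ} {p : K[X]} :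
    p ∈ primesLE K n ↔ p.Monic ∧ p.natDegree ≤ n ∧ Irreducible p := by
  simp only [primesLE, Finset.mem_filter, Finset.mem_biUnion, Finset.mem_range, mem_monics]
  constructor
  · rintro ⟨⟨k, hk, hp, rfl⟩, hi⟩
    exact ⟨hp, by omega, hi⟩
  · rintro ⟨hp, hk, hi⟩
    exact ⟨⟨_, by omega, hp, rfl⟩, hi⟩

open Classical in
/-- The degree counted through prime power divisors. -/
theorem natDegree_eq_sum_prime_powers {f : K[X]} (hf : f.Monic) :
    f.natDegree = ∑ P ∈ primesLE K f.natDegree, ∑ j ∈ Finset.Icc 1 f.natDegree,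
      if P ^ j ∣ f then P.natDegree else 0 := by
  have hf0 : f ≠ 0 := hf.ne_zero
  set s := UniqueFactorizationMonoid.normalizedFactors f with hs
  have hmem {P : K[X]} (hP : P ∈ s) : P.Monic ∧ P.natDegree ≤ f.natDegree ∧ Irreducible P := by
    have hi := UniqueFactorizationMonoid.irreducible_of_normalized_factor P hP
    refine ⟨?_, natDegree_le_of_dvd (UniqueFactorizationMonoid.dvd_of_mem_normalizedFactors hP) hf0,
      hi⟩
    have := UniqueFactorizationMonoid.normalize_normalized_factor P hP
    rw [← this]
    exact monic_normalize hi.ne_zero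
  have hprod : s.prod = f := by
    rw [hs, UniqueFactorizationMonoid.prod_normalizedFactors_eq hf0, hf.normalize_eq_self]
  have hpow {P : K[X]} (hP : P.Monic) (hi : Irreducible P) (j : ℕ) :
      P ^ j ∣ f ↔ j ≤ s.count P := by
    rw [pow_dvd_iff_le_emultiplicity,
      UniqueFactorizationMonoid.emultiplicity_eq_count_normalizedFactors hi hf0,
      hP.normalize_eq_self, Nat.cast_le]
  have hcount {P : K[X]} (hP : P.Monic) (hi : Irreducible P) : s.count P ≤ f.natDegree := by
    have h := natDegree_le_of_dvd ((hpow hP hi _).2 le_rfl) hf0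
    rw [hP.natDegree_pow] at h
    exact (Nat.le_mul_of_pos_right _ hi.natDegree_pos).trans h
  have hdeg : f.natDegree = ∑ P ∈ s.toFinset, s.count P * P.natDegree := by
    conv_lhs => rw [← hprod]
    rw [natDegree_multiset_prod_of_monic _ fun P hP => (hmem hP).1, Finset.sum_multiset_map_count]
    simp
  rw [hdeg, ← hdeg]
  rw [Finset.sum_subset (s₂ := primesLE K f.natDegree)
    (fun P hP => mem_primesLE.2 (hmem (Multiset.mem_toFinset.1 hP)))
    (fun P _ hP => by
      rw [Multiset.mem_toFinset] at hP
      simp [Multiset.count_eq_zero_of_notMem hP])] at hdeg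
  conv_lhs => rw [hdeg]
  refine Finset.sum_congr rfl fun P hP => ?_
  obtain ⟨hP1, -, hP3⟩ := mem_primesLE.1 hP
  rw [← Finset.sum_filter, Finset.sum_const, smul_eq_mul]
  congr 1
  -- The exponents j counted are those up to the multiplicity of P, which never exceeds deg f, so
  -- the range loses nothing.
  have : (Finset.Icc 1 f.natDegree).filter (fun j => P ^ j ∣ f) = Finset.Icc 1 (s.count P) := by
    ext j
    have := hcount hP1 hP3
    simp only [Finset.mem_filter, Finset.mem_Icc, hpow hP1 hP3]
    omega
  rw [this, Nat.card_Icc, Nat.add_sub_cancel]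

/-- The sum of a function over the monic polynomials of degree `n`. -/
def monicSum (h : K[X] → ℂ) (n : ℕ) : ℂ := ∑ f ∈ monics K n, h f

/-- The power sum attached to a completely multiplicative function, as a sum over prime powers. -/
def primePowerSum (h : K[X] → ℂ) (n : ℕ) : ℂ :=
  ∑ P ∈ primesLE K n, ∑ j ∈ Finset.Icc 1 n, if P.natDegree * j = n then P.natDegree * h P ^ j else 0

/-- The condition deg P · j = n bounds both deg P and j by n, so longer ranges add only zeros. Power
sums of different index thus share one range in Newton's identity. -/
theorem primePowerSum_eq (h : K[X] → ℂ) {n N : ℕ} (hN : n ≤ N) :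
    primePowerSum h n = ∑ P ∈ primesLE K N, ∑ j ∈ Finset.Icc 1 N,
      if P.natDegree * j = n then P.natDegree * h P ^ j else 0 := by
  classical
  rw [primePowerSum]
  refine Finset.sum_subset_zero_on_sdiff ?_ ?_ ?_
  · intro P hP
    rw [mem_primesLE] at hP ⊢
    exact ⟨hP.1, hP.2.1.trans hN, hP.2.2⟩
  · intro P hP
    simp only [Finset.mem_sdiff, mem_primesLE, not_and] at hP
    refine Finset.sum_eq_zero fun j hj => if_neg fun hk => hP.2 hP.1.1 ?_ hP.1.2.2
    rw [← hk]
    exact Nat.le_mul_of_pos_right _ (Finset.mem_Icc.1 hj).1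
  · intro P hP
    refine Finset.sum_subset_zero_on_sdiff (Finset.Icc_subset_Icc_right hN) ?_ fun _ _ => rfl
    intro j hj
    rw [Finset.mem_sdiff, Finset.mem_Icc, Finset.mem_Icc] at hj
    refine if_neg fun hk => hj.2 ⟨hj.1.1, ?_⟩
    rw [← hk]
    exact Nat.le_mul_of_pos_left _ (mem_primesLE.1 hP).2.2.natDegree_pos

open Classical in
theorem sum_monics_of_dvd {h : K[X] → ℂ}
    (hmul : ∀ f g : K[X], f.Monic → g.Monic → h (f * g) = h f * h g)
    {n : ℕ} {Q : K[X]} (hQ : Q.Monic) (hQn : Q.natDegree ≤ n) :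
    ∑ f ∈ (monics K n).filter (Q ∣ ·), h f = h Q * monicSum h (n - Q.natDegree) := by
  rw [monicSum, Finset.mul_sum]
  symm
  refine Finset.sum_bij (fun g _ => Q * g) ?_ ?_ ?_ ?_
  · intro g hg
    rw [mem_monics] at hg
    rw [Finset.mem_filter, mem_monics, hQ.natDegree_mul hg.1, hg.2]
    exact ⟨⟨hQ.mul hg.1, by omega⟩, dvd_mul_right _ _⟩
  · intro g _ g' _ hgg
    exact mul_left_cancel₀ hQ.ne_zero hgg
  · intro f hf
    rw [Finset.mem_filter, mem_monics] at hf
    obtain ⟨⟨hf1, hf2⟩, g, rfl⟩ := hf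
    have hg := hQ.of_mul_monic_left hf1
    refine ⟨g, mem_monics.2 ⟨hg, ?_⟩, rfl⟩
    rw [hQ.natDegree_mul hg] at hf2
    omega
  · intro g hg
    rw [hmul _ _ hQ (mem_monics.1 hg).1]

/-- Newton's identities for completely multiplicative functions on monic polynomials. -/
theorem newton_identity {h : K[X] → ℂ} (hone : h 1 = 1)
    (hmul : ∀ f g : K[X], f.Monic → g.Monic → h (f * g) = h f * h g) (n : ℕ) :
    n * monicSum h n = ∑ k ∈ Finset.Icc 1 n, primePowerSum h k * monicSum h (n - k) := by
  classical
  have hpow {P : K[X]} (hP : P.Monic) (j : ℕ) : h (P ^ j) = h P ^ j := by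
    induction j with
    | zero => simpa using hone
    | succ j ih => rw [pow_succ, hmul _ _ (hP.pow j) hP, ih, pow_succ]
  -- Logarithmic differentiation in combinatorial form: n = deg f is spread over the prime powers
  -- dividing f.
  have h1 : n * monicSum h n = ∑ f ∈ monics K n, ∑ P ∈ primesLE K n, ∑ j ∈ Finset.Icc 1 n,
      if P ^ j ∣ f then P.natDegree * h f else 0 := by
    rw [monicSum, Finset.mul_sum]
    refine Finset.sum_congr rfl fun f hf => ?_
    obtain ⟨hf1, rfl⟩ := mem_monics.1 hf
    have := congrArg (fun k : ℕ => (k : ℂ) * h f) (natDegree_eq_sum_prime_powers hf1)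
    simpa [Finset.sum_mul, ite_mul] using this
  rw [h1, Finset.sum_comm]
  -- Writing f = P^j g, the sum over multiples of P^j splits into h(P)^j times a sum over g of
  -- degree n - j deg P.
  have h2 : ∀ P ∈ primesLE K n, ∀ j ∈ Finset.Icc 1 n,
      (∑ f ∈ monics K n, if P ^ j ∣ f then P.natDegree * h f else 0) =
        ∑ k ∈ Finset.Icc 1 n,
          (if P.natDegree * j = k then P.natDegree * h P ^ j else 0) * monicSum h (n - k) := by
    intro P hP j hj
    obtain ⟨hP1, -, hP3⟩ := mem_primesLE.1 hP
    rw [← Finset.sum_filter, ← Finset.mul_sum]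
    have hd : (P ^ j).natDegree = P.natDegree * j := by rw [hP1.natDegree_pow, mul_comm]
    simp only [ite_mul, zero_mul, Finset.sum_ite_eq]
    have h1j := (Finset.mem_Icc.1 hj).1
    have hpos := hP3.natDegree_pos
    by_cases hle : P.natDegree * j ≤ n
    · rw [sum_monics_of_dvd hmul (hP1.pow j) (hd.trans_le hle), hd, hpow hP1, if_pos, mul_assoc]
      exact Finset.mem_Icc.2 ⟨Nat.mul_pos hpos h1j, hle⟩
    · rw [if_neg fun hm => hle (Finset.mem_Icc.1 hm).2, Finset.filter_false_of_mem, Finset.sum_empty,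
        mul_zero]
      intro f hf hdvd
      obtain ⟨hf1, rfl⟩ := mem_monics.1 hf
      exact hle (hd ▸ natDegree_le_of_dvd hdvd hf1.ne_zero)
  have h3 : ∀ P ∈ primesLE K n, (∑ f ∈ monics K n, ∑ j ∈ Finset.Icc 1 n,
      if P ^ j ∣ f then P.natDegree * h f else 0) = ∑ k ∈ Finset.Icc 1 n, ∑ j ∈ Finset.Icc 1 n,
          (if P.natDegree * j = k then P.natDegree * h P ^ j else 0) * monicSum h (n - k) := by
    intro P hP
    rw [Finset.sum_comm, Finset.sum_congr rfl (h2 P hP), Finset.sum_comm]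
  rw [Finset.sum_congr rfl h3, Finset.sum_comm]
  refine Finset.sum_congr rfl fun k hk => ?_
  rw [Finset.mem_Icc] at hk
  rw [primePowerSum_eq h hk.2, Finset.sum_mul]
  exact Finset.sum_congr rfl fun P _ => by rw [Finset.sum_mul]

end Newton

/-! ### Minimal polynomials and character sums over the extension -/

theorem pow_card_pow_injective (K : Type*) {L : Type*} [Field K] [Field L] [Algebra K L] [Finite K]
    (i : ℕ) : Function.Injective fun a : L => a ^ Nat.card K ^ i := by
  have := Fintype.ofFinite K
  induction i with
  | zero => intro a b h; simpa using h
  | succ i ih =>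
    intro a b h
    simp only [pow_succ, pow_mul] at h
    exact ih ((FiniteField.frobeniusAlgHom K L).injective
      (by simpa [FiniteField.frobeniusAlgHom_apply, Nat.card_eq_fintype_card] using h))

section Extension
variable {K L : Type*} [Field K] [Field L] [Algebra K L] [Finite K] [FiniteDimensional K L]

theorem pow_card_pow_eq_iff (a : L) (e : ℕ) :
    a ^ Nat.card K ^ e = a ↔ (minpoly K a).natDegree ∣ e := by
  have hint : IsIntegral K a := Algebra.IsIntegral.isIntegral a
  rw [(minpoly.irreducible hint).natDegree_dvd_iff_dvd_X_pow_card_pow_sub_X,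
    minpoly.dvd_iff]
  simp [sub_eq_zero]

/-- The conjugates a^{q^i} with i < d are distinct roots, so the product of their linear factors
divides the minimal polynomial; both are monic of degree d. -/
theorem minpoly_map_eq_prod (a : L) :
    (minpoly K a).map (algebraMap K L) =
      ∏ i ∈ Finset.range (minpoly K a).natDegree, (X - C (a ^ Nat.card K ^ i)) := by
  have hint : IsIntegral K a := Algebra.IsIntegral.isIntegral a
  have := Fintype.ofFinite K
  set d := (minpoly K a).natDegree with hd
  have hroot (i : ℕ) : (X - C (a ^ Nat.card K ^ i)) ∣ (minpoly K a).map (algebraMap K L) := by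
    rw [dvd_iff_isRoot, IsRoot, eval_map_algebraMap]
    induction i with
    | zero => simp
    | succ i ih =>
      have := congrArg (FiniteField.frobeniusAlgHom K L) ih
      rw [← aeval_algHom_apply, map_zero] at this
      simpa [FiniteField.frobeniusAlgHom_apply, pow_succ, pow_mul,
        Nat.card_eq_fintype_card] using this
  have hinj : ∀ i < d, ∀ j < d, i ≤ j → a ^ Nat.card K ^ i = a ^ Nat.card K ^ j → i = j := by
    intro i _ j hj hij h
    have h2 : a ^ Nat.card K ^ (j - i) = a := by
      apply pow_card_pow_injective K i
      simp only
      rw [← pow_mul, ← pow_add, Nat.sub_add_cancel hij, h]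
    have := Nat.eq_zero_of_dvd_of_lt ((pow_card_pow_eq_iff a _).1 h2) (by omega)
    omega
  refine eq_of_monic_of_dvd_of_natDegree_le
    (monic_prod_of_monic _ _ fun i _ => monic_X_sub_C _) ((minpoly.monic hint).map _) ?_ ?_
  · refine Finset.prod_dvd_of_coprime ?_ fun i _ => hroot i
    intro i hi j hj hij
    refine (isCoprime_X_sub_C_of_isUnit_sub ?_)
    rw [isUnit_iff_ne_zero, sub_ne_zero]
    intro h
    rw [Finset.mem_coe, Finset.mem_range] at hi hj
    rcases le_total i j with hle | hle
    · exact hij (hinj i hi j hj hle h)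
    · exact hij (hinj j hj i hi hle h.symm).symm
  · rw [natDegree_map, natDegree_prod_of_monic _ _ fun i _ => monic_X_sub_C _]
    simp only [natDegree_X_sub_C, Finset.sum_const, Finset.card_range, smul_eq_mul, mul_one, hd,
      le_refl]

variable (K) in
/-- The class of the characteristic polynomial of `a` over `K`. -/
def ofElement (a : L) : TruncUnit K :=
  (Module.finrank K L / (minpoly K a).natDegree) • ofPoly (minpoly K a)

/-- The Frobenius orbit of a has period d = deg of its minimal polynomial, so the sum over n
conjugates is n/d copies of the sum over one period. The factors X - a reverse to 1 - at, and
characteristic two removes the sign. -/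
theorem map_ofElement [CharP L 2] (a : L) :
    map (algebraMap K L) (ofElement K a) =
      ⟨T1 (Nat.card K) (Module.finrank K L) a, T2 (Nat.card K) (Module.finrank K L) a,
        T3 (Nat.card K) (Module.finrank K L) a⟩ := by
  have hint : IsIntegral K a := Algebra.IsIntegral.isIntegral a
  obtain ⟨k, hk⟩ := minpoly.degree_dvd hint
  set d := (minpoly K a).natDegree with hd
  have hd0 : 0 < d := minpoly.natDegree_pos hint
  have hper (j : ℕ) : ∑ i ∈ Finset.range (d * j), (⟨a ^ Nat.card K ^ i, 0, 0⟩ : TruncUnit L) =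
      j • ∑ i ∈ Finset.range d, (⟨a ^ Nat.card K ^ i, 0, 0⟩ : TruncUnit L) := by
    induction j with
    | zero => simp
    | succ j ih =>
      rw [Nat.mul_succ, Finset.sum_range_add, ih, succ_nsmul]
      congr 1
      refine Finset.sum_congr rfl fun i _ => ?_
      rw [pow_add, pow_mul, (pow_card_pow_eq_iff a _).2 (dvd_mul_right _ _)]
  rw [← sum_frobenius_eq, ofElement, map_nsmul, ← ofPoly_map, minpoly_map_eq_prod,
    ofPoly_prod _ _ fun i _ => monic_X_sub_C _, ← hd, hk, Nat.mul_div_cancel_left _ hd0, hper]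
  simp only [ofPoly_X_sub_C, CharTwo.neg_eq]

-- P divides X^{|L|} - X, so it splits in L, and it is separable because finite fields are perfect;
-- the fiber is its set of roots.
open Classical in
theorem card_minpoly_eq [Fintype L] {P : K[X]} (hP : P.Monic) (hi : Irreducible P)
    (hdvd : P.natDegree ∣ Module.finrank K L) :
    (Finset.univ.filter fun a : L => minpoly K a = P).card = P.natDegree := by
  have hP' : (P.map (algebraMap K L)) ∣ (X ^ Fintype.card L - X : L[X]) := by
    have h := hi.natDegree_dvd_iff_dvd_X_pow_card_pow_sub_X.1 hdvd
    have := Polynomial.map_dvd (algebraMap K L) h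
    rwa [← Module.natCard_eq_pow_finrank, Polynomial.map_sub, Polynomial.map_pow, map_X,
      Nat.card_eq_fintype_card] at this
  have hne : (X ^ Fintype.card L - X : L[X]) ≠ 0 :=
    FiniteField.X_pow_card_sub_X_ne_zero L Fintype.one_lt_card
  have hsplit : (P.map (algebraMap K L)).Splits :=
    Splits.of_dvd (by rw [← Nat.card_eq_fintype_card]; exact splits_X_pow_nat_card_sub_X) hne hP'
  have hsep : (P.map (algebraMap K L)).Separable := by
    rw [separable_map]
    exact PerfectField.separable_of_irreducible hi
  have : (Finset.univ.filter fun a : L => minpoly K a = P) =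
      (P.map (algebraMap K L)).roots.toFinset := by
    ext a
    rw [Finset.mem_filter, Multiset.mem_toFinset, mem_roots (hP.map _).ne_zero, IsRoot,
      eval_map_algebraMap]
    constructor
    · rintro ⟨-, rfl⟩
      exact minpoly.aeval _ _
    · intro h
      exact ⟨Finset.mem_univ _, (minpoly.eq_of_irreducible_of_monic hi h hP).symm⟩
  rw [this, Multiset.toFinset_card_of_nodup (nodup_roots hsep), ← hsplit.natDegree_eq_card_roots,
    natDegree_map]

/-- The value of a character at a polynomial. -/
def charPoly (χ : AddChar (TruncUnit K) ℂ) (p : K[X]) : ℂ := χ (ofPoly p)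

/-- A prime P of degree d with n = dk is the minimal polynomial of d elements, each contributing
χ(P)^k; primes whose degree does not divide n contribute to neither side. -/
theorem sum_ofElement [Fintype L] (χ : AddChar (TruncUnit K) ℂ) :
    ∑ a : L, χ (ofElement K a) = primePowerSum (charPoly χ) (Module.finrank K L) := by
  classical
  have hn : 0 < Module.finrank K L := Module.finrank_pos
  set n := Module.finrank K L with hnd
  have hmaps : ∀ a ∈ (Finset.univ : Finset L), minpoly K a ∈ primesLE K n := by
    intro a _
    have hint : IsIntegral K a := Algebra.IsIntegral.isIntegral a
    exact mem_primesLE.2 ⟨minpoly.monic hint, Nat.le_of_dvd hn (minpoly.degree_dvd hint),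
      minpoly.irreducible hint⟩
  rw [← Finset.sum_fiberwise_of_maps_to hmaps, primePowerSum]
  refine Finset.sum_congr rfl fun P hP => ?_
  obtain ⟨hP1, hP2, hP3⟩ := mem_primesLE.1 hP
  have hpos := hP3.natDegree_pos
  by_cases hdvd : P.natDegree ∣ n
  · obtain ⟨k, hk⟩ := hdvd
    have h1 : ∀ a ∈ Finset.univ.filter (fun a : L => minpoly K a = P),
        χ (ofElement K a) = charPoly χ P ^ k := by
      intro a ha
      rw [Finset.mem_filter] at ha
      rw [ofElement, ha.2, ← hnd, hk, Nat.mul_div_cancel_left _ hpos, AddChar.map_nsmul_eq_pow,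
        charPoly]
    rw [Finset.sum_congr rfl h1, Finset.sum_const, card_minpoly_eq hP1 hP3 ⟨k, hk⟩, nsmul_eq_mul,
      Finset.sum_eq_single k, if_pos hk.symm]
    · intro j _ hj
      refine if_neg fun h => hj (Nat.eq_of_mul_eq_mul_left hpos (h.trans hk))
    · intro h
      refine absurd (Finset.mem_Icc.2 ⟨?_, ?_⟩) h
      · rcases k with _ | k
        · omega
        · omega
      · rw [hk]
        exact Nat.le_mul_of_pos_left _ hpos
  · rw [Finset.sum_eq_zero (s := Finset.Icc 1 n), Finset.filter_false_of_mem, Finset.sum_empty]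
    · rintro a _ rfl
      exact hdvd (minpoly.degree_dvd (Algebra.IsIntegral.isIntegral a))
    · intro j _
      exact if_neg fun h => hdvd ⟨j, h.symm⟩

end Extension

theorem card_mul_traceCount {K L : Type*} [Field K] [Field L] [Algebra K L] [Fintype K]
    [CharP K 2] [FiniteDimensional K L] :
    (Fintype.card K : ℂ) ^ 3 * traceCount K L 0 0 0 =
      ∑ χ : AddChar (TruncUnit K) ℂ, primePowerSum (charPoly χ) (Module.finrank K L) := by
  classical
  have : CharP L 2 := charP_of_injective_algebraMap (algebraMap K L).injective 2
  have : Finite L := Module.finite_of_finite K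
  have := Fintype.ofFinite L
  have h1 : traceCount K L 0 0 0 = (Finset.univ.filter fun a : L => ofElement K a = 0).card := by
    rw [traceCount, ← Fintype.card_subtype, ← Nat.card_eq_fintype_card]
    refine Nat.card_congr (Equiv.subtypeEquivRight fun a => ?_)
    rw [← (map_injective (algebraMap K L).injective).eq_iff, map_ofElement, map_zero]
    simp [TruncUnit.ext_iff]
  simp_rw [← sum_ofElement (L := L)]
  rw [Finset.sum_comm]
  simp_rw [AddChar.sum_apply_eq_ite]
  rw [h1, ← Finset.sum_filter, Finset.sum_const, card_eq]
  push_cast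
  rw [nsmul_eq_mul, mul_comm]

/-! ### Vanishing of high coefficients of the L-series -/

section Recurrence
variable {K : Type*} [Field K]

theorem charPoly_one (χ : AddChar (TruncUnit K) ℂ) : charPoly χ 1 = 1 := by
  rw [charPoly, ofPoly_one, AddChar.map_zero_eq_one]

theorem charPoly_mul (χ : AddChar (TruncUnit K) ℂ) (f g : K[X]) (hf : f.Monic) (hg : g.Monic) :
    charPoly χ (f * g) = charPoly χ f * charPoly χ g := by
  rw [charPoly, ofPoly_mul hf hg, AddChar.map_add_eq_mul, charPoly, charPoly]

theorem natDegree_add_C_mul_X_pow {f : K[X]} {k : ℕ} (hk : 1 ≤ k) (hkn : k ≤ f.natDegree)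
    (c : K) : (f + C c * X ^ (f.natDegree - k)).natDegree = f.natDegree := by
  refine natDegree_add_eq_left_of_natDegree_lt ?_
  exact (natDegree_C_mul_X_pow_le _ _).trans_lt (by omega)

theorem reverse_add_C_mul_X_pow {f : K[X]} {k : ℕ} (hk : 1 ≤ k) (hkn : k ≤ f.natDegree) (c : K)
    (j : ℕ) : (f + C c * X ^ (f.natDegree - k)).reverse.coeff j =
      f.reverse.coeff j + if j = k then c else 0 := by
  rw [coeff_reverse, natDegree_add_C_mul_X_pow hk hkn, coeff_add, ← coeff_reverse, coeff_C_mul_X_pow]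
  congr 1
  refine if_congr ?_ rfl rfl
  by_cases hj : j ≤ f.natDegree
  · rw [revAt_le hj]; omega
  · rw [revAt_eq_self_of_lt (by omega)]; omega

variable [Finite K]

/-- Adding c X^{n-k} permutes the monic polynomials of degree n and multiplies the sum by z ≠ 1. -/
theorem monicSum_eq_zero_of_shift {h : K[X] → ℂ} {n k : ℕ} (hk : 1 ≤ k) (hkn : k ≤ n) {c : K}
    {z : ℂ} (hz : z ≠ 1)
    (hshift : ∀ f ∈ monics K n, h (f + C c * X ^ (n - k)) = h f * z) : monicSum h n = 0 := by
  have hmem (c : K) {f : K[X]} (hf : f ∈ monics K n) : f + C c * X ^ (n - k) ∈ monics K n := by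
    obtain ⟨hf1, rfl⟩ := mem_monics.1 hf
    refine mem_monics.2 ⟨hf1.add_of_left ?_, natDegree_add_C_mul_X_pow hk hkn c⟩
    refine (degree_C_mul_X_pow_le _ _).trans_lt ?_
    rw [degree_eq_natDegree hf1.ne_zero, Nat.cast_lt]
    omega
  have h1 : monicSum h n = monicSum h n * z := by
    conv_rhs => rw [monicSum, Finset.sum_mul]
    rw [← Finset.sum_congr rfl hshift, monicSum]
    symm
    refine Finset.sum_nbij' (fun f => f + C c * X ^ (n - k)) (fun f => f + C (-c) * X ^ (n - k))
      (fun f hf => hmem c hf) (fun f hf => hmem (-c) hf) ?_ ?_ fun _ _ => rfl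
    · intro f _; simp
    · intro f _; simp
  by_contra h0
  exact hz (mul_left_cancel₀ h0 (by rw [mul_one]; exact h1.symm))

theorem monicSum_eq_zero_of_three {χ : AddChar (TruncUnit K) ℂ} {c : K} (hc : χ ⟨0, 0, c⟩ ≠ 1)
    {n : ℕ} (hn : 3 ≤ n) : monicSum (charPoly χ) n = 0 := by
  refine monicSum_eq_zero_of_shift (c := c) (by norm_num) hn hc fun f hf => ?_
  obtain ⟨-, rfl⟩ := mem_monics.1 hf
  rw [charPoly, charPoly, ← AddChar.map_add_eq_mul, add_mk_zero]
  simp [ofPoly, reverse_add_C_mul_X_pow _ hn]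

theorem monicSum_eq_zero_of_two {χ : AddChar (TruncUnit K) ℂ} (h3 : ∀ v, χ ⟨0, 0, v⟩ = 1) {c : K}
    (hc : χ ⟨0, c, 0⟩ ≠ 1) {n : ℕ} (hn : 2 ≤ n) : monicSum (charPoly χ) n = 0 := by
  refine monicSum_eq_zero_of_shift (c := c) (by norm_num) hn hc fun f hf => ?_
  obtain ⟨-, rfl⟩ := mem_monics.1 hf
  -- The group law creates a cross term c₁c, but only in the t³ coefficient, where χ is trivial.
  have : ofPoly (f + C c * X ^ (f.natDegree - 2)) =
      ofPoly f + ⟨0, c, 0⟩ + ⟨0, 0, -((ofPoly f).c₁ * c)⟩ := by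
    ext <;> simp [ofPoly, reverse_add_C_mul_X_pow _ hn]
  rw [charPoly, charPoly, this, AddChar.map_add_eq_mul, AddChar.map_add_eq_mul, h3, mul_one]

theorem monicSum_eq_zero_of_one {χ : AddChar (TruncUnit K) ℂ} (h2 : ∀ u v, χ ⟨0, u, v⟩ = 1) {c : K}
    (hc : χ ⟨c, 0, 0⟩ ≠ 1) {n : ℕ} (hn : 1 ≤ n) : monicSum (charPoly χ) n = 0 := by
  refine monicSum_eq_zero_of_shift (c := c) (by norm_num) hn hc fun f hf => ?_
  obtain ⟨-, rfl⟩ := mem_monics.1 hf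
  have : ofPoly (f + C c * X ^ (f.natDegree - 1)) = ofPoly f + ⟨c, 0, 0⟩ +
      ⟨0, -((ofPoly f).c₁ * c),
        -((ofPoly f).c₂ * c) + ((ofPoly f).c₁ + c) * ((ofPoly f).c₁ * c)⟩ := by
    ext <;> simp [ofPoly, reverse_add_C_mul_X_pow _ hn]
  rw [charPoly, charPoly, this, AddChar.map_add_eq_mul, AddChar.map_add_eq_mul, h2, mul_one]

theorem monicSum_zero (χ : AddChar (TruncUnit K) ℂ) : monicSum (charPoly χ) 0 = 1 := by
  have : monics K 0 = {1} := by
    ext f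
    rw [mem_monics, Finset.mem_singleton]
    exact ⟨fun h => (Monic.natDegree_eq_zero h.1).1 h.2, by rintro rfl; simp⟩
  rw [monicSum, this, Finset.sum_singleton, charPoly_one]

end Recurrence

/-! ### The first two coefficients of the L-series -/

section LowDegree
variable {K : Type*} [Field K] [Fintype K]

theorem monicSum_one (χ : AddChar (TruncUnit K) ℂ) :
    monicSum (charPoly χ) 1 = ∑ a : K, χ ⟨a, 0, 0⟩ := by
  symm
  refine Finset.sum_bij (fun a _ => X + C a) ?_ ?_ ?_ ?_
  · intro a _
    exact mem_monics.2 ⟨monic_X_add_C a, natDegree_X_add_C a⟩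
  · intro a _ b _ h
    exact C_injective (add_left_cancel h)
  · intro f hf
    obtain ⟨h1, h2⟩ := mem_monics.1 hf
    refine ⟨f.coeff 0, Finset.mem_univ _, ?_⟩
    have := eq_X_add_C_of_natDegree_le_one h2.le
    rw [← h2, coeff_natDegree, h1.leadingCoeff, C_1, one_mul] at this
    exact this.symm
  · intro a _
    have : (X + C a : K[X]) = X - C (-a) := by simp
    rw [charPoly, this, ofPoly_X_sub_C, neg_neg]

theorem monicSum_two (χ : AddChar (TruncUnit K) ℂ) :
    monicSum (charPoly χ) 2 = ∑ a : K, ∑ b : K, χ ⟨a, b, 0⟩ := by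
  rw [← Fintype.sum_prod_type']
  symm
  have hdeg (a b : K) : (C 1 * X ^ 2 + C a * X + C b : K[X]).natDegree = 2 :=
    natDegree_quadratic one_ne_zero
  refine Finset.sum_bij (fun a _ => C 1 * X ^ 2 + C a.1 * X + C a.2) ?_ ?_ ?_ ?_
  · intro a _
    refine mem_monics.2 ⟨?_, hdeg _ _⟩
    rw [Monic, leadingCoeff_quadratic one_ne_zero]
  · intro a _ b _ h
    have h0 := congrArg (coeff · 0) h
    have h1 := congrArg (coeff · 1) h
    simp [coeff_X, coeff_C] at h0 h1
    exact Prod.ext h1 h0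
  · intro f hf
    obtain ⟨h1, h2⟩ := mem_monics.1 hf
    refine ⟨(f.coeff 1, f.coeff 0), Finset.mem_univ _, ?_⟩
    have h3 : f.coeff 2 = 1 := by rw [← h2]; exact h1
    ext k
    rcases k with _ | _ | _ | k
    · simp
    · simp [coeff_C]
    · simp [h3]
    · have hk : f.natDegree < k + 1 + 1 + 1 := by omega
      rw [coeff_eq_zero_of_natDegree_lt hk]
      refine coeff_eq_zero_of_natDegree_lt ?_
      rw [hdeg]
      omega
  · intro a _
    have h3 : revAt 2 3 = 3 := revAt_eq_self_of_lt (by norm_num)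
    rw [charPoly, ofPoly, ofPoly_coeff (by rw [hdeg]; norm_num), ofPoly_coeff (by rw [hdeg]),
      coeff_reverse, hdeg, h3]
    simp [coeff_X, coeff_C]

end LowDegree

/-! ### Lucas sequences and the power sums of quadratic L-polynomials -/

/-- The pairs `(α^{2m} + β^{2m}, (α^{2m+1} + β^{2m+1}) / (α + β))` for `αβ = 1` and
`(α + β)² = R`. -/
def lucasPair (R : ℤ) : ℕ → ℤ × ℤ
  | 0 => (2, 1)
  | m + 1 => (R * (lucasPair R m).2 - (lucasPair R m).1,
      R * (lucasPair R m).2 - (lucasPair R m).1 - (lucasPair R m).2)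

/-- For R = 1, 2, 4 one may take α = e^{iπ/3}, e^{iπ/4}, 1, so that α²⁴ = 1; a shift of 12 in m is a
shift of 24 in the exponent. -/
theorem lucasPair_add_twelve {R : ℤ} (hR : R = 1 ∨ R = 2 ∨ R = 4) (m : ℕ) :
    lucasPair R (m + 12) = lucasPair R m := by
  induction m with
  | zero => rcases hR with rfl | rfl | rfl <;> rfl
  | succ m ih =>
    rw [show m + 1 + 12 = m + 12 + 1 by ring, lucasPair.eq_def R (m + 12 + 1),
      lucasPair.eq_def R (m + 1)]
    simp only [ih]

theorem lucasPair_add_mul_twelve {R : ℤ} (hR : R = 1 ∨ R = 2 ∨ R = 4) (m t : ℕ) :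
    lucasPair R (12 * t + m) = lucasPair R m := by
  induction t with
  | zero => simp
  | succ t ih => rw [show 12 * (t + 1) + m = 12 * t + m + 12 by ring, lucasPair_add_twelve hR, ih]

/-- Here α = i and β = -i; this is the case of vanishing first coefficient. -/
theorem lucasPair_zero_fst (m : ℕ) : (lucasPair 0 m).1 = 2 * (-1) ^ m := by
  induction m with
  | zero => rfl
  | succ m ih => rw [lucasPair, ih, pow_succ]; ring

section Recurrence
variable {K : Type*} [Field K] [Finite K] {χ : AddChar (TruncUnit K) ℂ}

theorem primePowerSum_one (χ : AddChar (TruncUnit K) ℂ) :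
    primePowerSum (charPoly χ) 1 = monicSum (charPoly χ) 1 := by
  have := newton_identity (charPoly_one χ) (charPoly_mul χ) 1
  simp [monicSum_zero] at this
  exact this.symm

theorem primePowerSum_two (χ : AddChar (TruncUnit K) ℂ) :
    primePowerSum (charPoly χ) 2 =
      2 * monicSum (charPoly χ) 2 - monicSum (charPoly χ) 1 ^ 2 := by
  have := newton_identity (charPoly_one χ) (charPoly_mul χ) 2
  rw [Finset.sum_Icc_succ_top (by norm_num), Finset.Icc_self, Finset.sum_singleton] at this
  simp [monicSum_zero, primePowerSum_one] at this
  linear_combination -this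

theorem primePowerSum_add_three (h : ∀ n, 3 ≤ n → monicSum (charPoly χ) n = 0) (n : ℕ) :
    primePowerSum (charPoly χ) (n + 3) =
      -monicSum (charPoly χ) 1 * primePowerSum (charPoly χ) (n + 2)
        - monicSum (charPoly χ) 2 * primePowerSum (charPoly χ) (n + 1) := by
  have := newton_identity (charPoly_one χ) (charPoly_mul χ) (n + 3)
  rw [h _ (by omega), Finset.sum_Icc_succ_top (by omega), Finset.sum_Icc_succ_top (by omega),
    Finset.sum_Icc_succ_top (by omega), Finset.sum_eq_zero] at this
  · simp only [Nat.sub_self, monicSum_zero, show n + 3 - (n + 2) = 1 by omega,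
      show n + 3 - (n + 1) = 2 by omega] at this
    linear_combination -this
  · intro k hk
    rw [h _ (by rw [Finset.mem_Icc] at hk; omega), mul_zero]

/-- The power sums in terms of the first two coefficients when these satisfy `c₁² = R c₂`. -/
theorem primePowerSum_eq_lucasPair (h : ∀ n, 3 ≤ n → monicSum (charPoly χ) n = 0) {R : ℤ}
    (hR : monicSum (charPoly χ) 1 ^ 2 = R * monicSum (charPoly χ) 2) (m : ℕ) :
    primePowerSum (charPoly χ) (2 * m + 1) =
        monicSum (charPoly χ) 1 * monicSum (charPoly χ) 2 ^ m * (lucasPair R m).2 ∧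
      primePowerSum (charPoly χ) (2 * m + 2) =
        -(monicSum (charPoly χ) 2 ^ (m + 1) * (lucasPair R (m + 1)).1) := by
  induction m with
  | zero =>
    refine ⟨by simp [lucasPair, primePowerSum_one], ?_⟩
    rw [mul_zero, zero_add, primePowerSum_two, hR]
    simp [lucasPair]
    ring
  | succ m ih =>
    have h1 : primePowerSum (charPoly χ) (2 * (m + 1) + 1) =
        monicSum (charPoly χ) 1 * monicSum (charPoly χ) 2 ^ (m + 1) * (lucasPair R (m + 1)).2 := by
      rw [show 2 * (m + 1) + 1 = 2 * m + 3 by ring, primePowerSum_add_three h, ih.1, ih.2]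
      simp only [lucasPair]
      push_cast
      ring
    refine ⟨h1, ?_⟩
    rw [show 2 * (m + 1) + 2 = 2 * m + 1 + 3 by ring, primePowerSum_add_three h,
      show 2 * m + 1 + 2 = 2 * (m + 1) + 1 by ring, h1, show 2 * m + 1 + 1 = 2 * m + 2 by ring, ih.2,
      lucasPair.eq_def R (m + 1 + 1)]
    push_cast
    linear_combination (-monicSum (charPoly χ) 2 ^ (m + 1) * (lucasPair R (m + 1)).2) * hR

/-- The L-polynomial is 1 + c₁T, with the single inverse root -c₁. -/
theorem primePowerSum_eq_pow (h : ∀ n, 2 ≤ n → monicSum (charPoly χ) n = 0) (n : ℕ) :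
    primePowerSum (charPoly χ) (n + 1) = -(-monicSum (charPoly χ) 1) ^ (n + 1) := by
  induction n with
  | zero => simp [primePowerSum_one]
  | succ n ih =>
    have := newton_identity (charPoly_one χ) (charPoly_mul χ) (n + 2)
    rw [h _ (by omega), Finset.sum_Icc_succ_top (by omega), Finset.sum_Icc_succ_top (by omega),
      Finset.sum_eq_zero] at this
    · simp only [Nat.sub_self, monicSum_zero, show n + 2 - (n + 1) = 1 by omega, ih] at this
      rw [pow_succ]
      linear_combination -this
    · intro k hk
      rw [h _ (by rw [Finset.mem_Icc] at hk; omega), mul_zero]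

theorem primePowerSum_eq_zero (h : ∀ n, 1 ≤ n → monicSum (charPoly χ) n = 0) (n : ℕ) :
    primePowerSum (charPoly χ) (n + 1) = 0 := by
  have := newton_identity (charPoly_one χ) (charPoly_mul χ) (n + 1)
  rw [h _ (by omega), Finset.sum_Icc_succ_top (by omega), Finset.sum_eq_zero] at this
  · simpa [monicSum_zero] using this.symm
  · intro k hk
    rw [h _ (by rw [Finset.mem_Icc] at hk; omega), mul_zero]

end Recurrence

/-! ### The trace character and its quadratic sums -/

section TraceChar
variable (K : Type*) [Field K] [CharP K 2]

/-- The additive character `x ↦ (-1)^{Tr x}` of a finite field of characteristic two. -/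
def traceChar : AddChar K ℂ :=
  letI := ZMod.algebra K 2
  (AddChar.zmodChar 2 (show (-1 : ℂ) ^ 2 = 1 by norm_num)).compAddMonoidHom
    (Algebra.trace (ZMod 2) K).toAddMonoidHom

variable {K}

theorem traceChar_mul_self (x : K) : traceChar K x * traceChar K x = 1 := by
  rw [← AddChar.map_add_eq_mul, CharTwo.add_self_eq_zero, AddChar.map_zero_eq_one]

theorem traceChar_eq_or (x : K) : traceChar K x = 1 ∨ traceChar K x = -1 :=
  mul_self_eq_one_iff.1 (traceChar_mul_self x)

variable [Fintype K]

theorem traceChar_sq (x : K) : traceChar K (x ^ 2) = traceChar K x := by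
  let _ := ZMod.algebra K 2
  have h : Algebra.trace (ZMod 2) K (x ^ 2) = Algebra.trace (ZMod 2) K x := by
    have := Algebra.trace_eq_of_algEquiv
      (FiniteField.frobeniusAlgEquivOfAlgebraic (ZMod 2) K) x
    simpa [FiniteField.coe_frobeniusAlgEquivOfAlgebraic] using this
  simp [traceChar, h]

theorem traceChar_ne_one : traceChar K ≠ 1 := by
  let _ := ZMod.algebra K 2
  obtain ⟨a, ha⟩ := Algebra.trace_surjective (ZMod 2) K 1
  rw [AddChar.ne_one_iff]
  refine ⟨a, ?_⟩
  have h : traceChar K a = -1 := by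
    simpa [traceChar, ha] using AddChar.zmodChar_apply' (n := 2)
      (show (-1 : ℂ) ^ 2 = 1 by norm_num) 1
  rw [h]
  norm_num

theorem sum_traceChar_mul [DecidableEq K] (c : K) :
    ∑ a : K, traceChar K (a * c) = if c = 0 then (Fintype.card K : ℂ) else 0 := by
  have := AddChar.sum_mulShift (R' := ℂ) c (AddChar.IsPrimitive.of_ne_one (traceChar_ne_one (K := K)))
  simpa using this

/-- Over characteristic two the form is secretly linear: with k = l², Tr(l²a²) = Tr(la), so the sum
vanishes unless l + l²s = 0, whose square is the stated condition. -/
theorem sum_traceChar_quadratic [DecidableEq K] (k s : K) :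
    ∑ a : K, traceChar K (k * (a * (a + s))) =
      if k = k ^ 2 * s ^ 2 then (Fintype.card K : ℂ) else 0 := by
  obtain ⟨l, rfl⟩ := FiniteField.isSquare_of_char_two (ringChar.eq_iff.2 (inferInstance : CharP K 2)) k
  have h (a : K) : traceChar K (l * l * (a * (a + s))) = traceChar K (a * (l + l * l * s)) := by
    rw [show l * l * (a * (a + s)) = (l * a) ^ 2 + l * l * a * s by ring, AddChar.map_add_eq_mul,
      traceChar_sq, ← AddChar.map_add_eq_mul]
    ring_nf
  simp_rw [h, sum_traceChar_mul]
  refine if_congr ?_ rfl rfl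
  rw [CharTwo.add_eq_zero, ← CharTwo.sq_inj]
  ring_nf

end TraceChar

/-! ### Characters with a given restriction, and the square of the Gauss sum -/

section Fiber
open scoped Classical
variable {K : Type*} [Field K]

/-- The restriction of a character to the elements `1 + a t`. -/
def lin (χ : AddChar (TruncUnit K) ℂ) (a : K) : ℂ := χ ⟨a, 0, 0⟩

theorem lin_zero (χ : AddChar (TruncUnit K) ℂ) : lin χ 0 = 1 := AddChar.map_zero_eq_one χ

variable [Fintype K] {l m : K} {χ : AddChar (TruncUnit K) ℂ}

theorem monicSum_one_eq (χ : AddChar (TruncUnit K) ℂ) :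
    monicSum (charPoly χ) 1 = ∑ a, lin χ a := monicSum_one χ

/-- The radical of the alternating form attached to `l` and `m`. -/
def rad (l m : K) : Finset K :=
  Finset.univ.filter fun b => l ^ 2 * b ^ 4 + m ^ 2 * b ^ 2 + l * b = 0

theorem mem_rad {b : K} : b ∈ rad l m ↔ l ^ 2 * b ^ 4 + m ^ 2 * b ^ 2 + l * b = 0 := by simp [rad]

theorem zero_mem_rad : (0 : K) ∈ rad l m := by simp [mem_rad]

variable [CharP K 2]

/-- The characters that restrict to `(u, v) ↦ (-1)^{Tr (m u + l v)}` on `1 + u t² + v t³`. -/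
def fiber (l m : K) : Finset (AddChar (TruncUnit K) ℂ) :=
  Finset.univ.filter fun χ => ∀ u v, χ ⟨0, u, v⟩ = traceChar K (m * u + l * v)

theorem mem_fiber : χ ∈ fiber l m ↔ ∀ u v, χ ⟨0, u, v⟩ = traceChar K (m * u + l * v) := by
  simp [fiber]

/-- The summand is a character of K × K; as trace values are their own inverses, it is trivial
exactly when χ has the prescribed restriction. -/
theorem sum_mul_traceChar (χ : AddChar (TruncUnit K) ℂ) (l m : K) :
    ∑ u, ∑ v, χ ⟨0, u, v⟩ * traceChar K (m * u + l * v) =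
      if χ ∈ fiber l m then (Fintype.card K : ℂ) ^ 2 else 0 := by
  let φ : AddChar (K × K) ℂ :=
    { toFun := fun p => χ ⟨0, p.1, p.2⟩ * traceChar K (m * p.1 + l * p.2)
      map_zero_eq_one' := by
        have : (⟨0, 0, 0⟩ : TruncUnit K) = 0 := rfl
        simp [this]
      map_add_eq_mul' := fun x y => by
        have h1 : (⟨0, (x + y).1, (x + y).2⟩ : TruncUnit K) = ⟨0, x.1, x.2⟩ + ⟨0, y.1, y.2⟩ := by
          ext <;> simp
        have h2 : m * (x + y).1 + l * (x + y).2 = (m * x.1 + l * x.2) + (m * y.1 + l * y.2) := by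
          simp; ring
        rw [h1, h2, AddChar.map_add_eq_mul, AddChar.map_add_eq_mul]
        ring }
  have hφ : φ = 0 ↔ χ ∈ fiber l m := by
    rw [mem_fiber, AddChar.eq_zero_iff, Prod.forall]
    refine forall₂_congr fun u v => ?_
    change χ ⟨0, u, v⟩ * traceChar K (m * u + l * v) = 1 ↔ _
    constructor
    · intro h
      rw [← mul_one (χ _), ← traceChar_mul_self (m * u + l * v), ← mul_assoc, h, one_mul]
    · intro h
      rw [h, traceChar_mul_self]
  have := AddChar.sum_eq_ite φ
  rw [Fintype.sum_prod_type] at this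
  rw [← if_congr hφ rfl rfl, pow_two, ← Nat.cast_mul, ← Fintype.card_prod]
  exact this

/-- Expand the indicator of the fiber by `sum_mul_traceChar`, then use orthogonality on G: only the
(u, v) inverse to g survives, which exists only if g has no linear term. -/
theorem sum_fiber (l m : K) (g : TruncUnit K) :
    ∑ χ ∈ fiber l m, χ g =
      if g.c₁ = 0 then Fintype.card K * traceChar K (m * g.c₂ + l * g.c₃) else 0 := by
  have h1 : (Fintype.card K : ℂ) ^ 2 * ∑ χ ∈ fiber l m, χ g =
      ∑ χ : AddChar (TruncUnit K) ℂ,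
        (∑ u, ∑ v, χ ⟨0, u, v⟩ * traceChar K (m * u + l * v)) * χ g := by
    simp_rw [sum_mul_traceChar, ite_mul, zero_mul]
    rw [← Finset.sum_filter, Finset.mul_sum]
    congr 1
    ext χ
    simp
  have h2 (u v : K) : g + ⟨0, u, v⟩ = 0 ↔ g.c₁ = 0 ∧ u = g.c₂ ∧ v = g.c₃ := by
    rw [add_mk_zero', TruncUnit.ext_iff]
    simp only [zero_c₁, zero_c₂, zero_c₃]
    constructor
    · rintro ⟨h1, h2, h3⟩
      rw [h1, zero_mul, add_zero] at h3
      exact ⟨h1, (CharTwo.add_eq_zero.1 h2).symm, (CharTwo.add_eq_zero.1 h3).symm⟩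
    · rintro ⟨h1, rfl, rfl⟩
      simp [h1, CharTwo.add_self_eq_zero]
  have h3 : ∑ χ : AddChar (TruncUnit K) ℂ,
        (∑ u, ∑ v, χ ⟨0, u, v⟩ * traceChar K (m * u + l * v)) * χ g =
      ∑ u, ∑ v, traceChar K (m * u + l * v) *
        if g + ⟨0, u, v⟩ = 0 then (Fintype.card K : ℂ) ^ 3 else 0 := by
    simp_rw [Finset.sum_mul]
    rw [Finset.sum_comm]
    refine Finset.sum_congr rfl fun u _ => ?_
    rw [Finset.sum_comm]
    refine Finset.sum_congr rfl fun v _ => ?_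
    have := AddChar.sum_apply_eq_ite (g + ⟨0, u, v⟩ : TruncUnit K)
    rw [card_eq] at this
    push_cast at this
    rw [← this, Finset.mul_sum]
    refine Finset.sum_congr rfl fun χ _ => ?_
    rw [AddChar.map_add_eq_mul χ]
    ring
  have hq : (Fintype.card K : ℂ) ≠ 0 := by simp
  refine mul_left_cancel₀ (pow_ne_zero 2 hq) ?_
  rw [h1, h3]
  by_cases hg : g.c₁ = 0
  · simp [h2, hg, ite_and, Finset.sum_ite_irrel]
    ring
  · simp [h2, hg]

/-- Each χ lies in exactly one fiber. This is obtained by summing indicators over l and m, which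
forces u = v = 0, without describing the dual of K × K. -/
theorem sum_eq_sum_fiber (F : AddChar (TruncUnit K) ℂ → ℂ) :
    ∑ χ, F χ = ∑ l : K, ∑ m : K, ∑ χ ∈ fiber l m, F χ := by
  have hq : (Fintype.card K : ℂ) ≠ 0 := by simp
  have h1 (χ : AddChar (TruncUnit K) ℂ) :
      ∑ l : K, ∑ m : K, (if χ ∈ fiber l m then (1 : ℂ) else 0) = 1 := by
    refine mul_left_cancel₀ (pow_ne_zero 2 hq) ?_
    rw [mul_one, Finset.mul_sum]
    have h2 (l : K) : (Fintype.card K : ℂ) ^ 2 * ∑ m, (if χ ∈ fiber l m then (1 : ℂ) else 0) =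
        ∑ m, ∑ u, ∑ v, χ ⟨0, u, v⟩ * (traceChar K (m * u) * traceChar K (l * v)) := by
      simp_rw [← AddChar.map_add_eq_mul, sum_mul_traceChar, Finset.mul_sum, mul_ite, mul_one,
        mul_zero]
    have h3 : ∑ l, ∑ m, ∑ u, ∑ v, χ ⟨0, u, v⟩ * (traceChar K (m * u) * traceChar K (l * v)) =
        ∑ u, ∑ v, χ ⟨0, u, v⟩ *
          ((∑ m, traceChar K (m * u)) * ∑ l, traceChar K (l * v)) := by
      simp_rw [Finset.sum_mul_sum, Finset.mul_sum]
      rw [Finset.sum_congr rfl fun l _ => Finset.sum_comm, Finset.sum_comm]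
      refine Finset.sum_congr rfl fun u _ => ?_
      rw [Finset.sum_congr rfl fun l _ => Finset.sum_comm, Finset.sum_comm]
      exact Finset.sum_congr rfl fun v _ => Finset.sum_comm
    rw [Finset.sum_congr rfl fun l _ => h2 l, h3]
    have h0 : (⟨0, 0, 0⟩ : TruncUnit K) = 0 := rfl
    simp [sum_traceChar_mul, h0, pow_two]
  calc ∑ χ, F χ = ∑ χ, F χ * ∑ l : K, ∑ m : K, (if χ ∈ fiber l m then (1 : ℂ) else 0) := by
        simp_rw [h1, mul_one]
    _ = _ := by
      simp_rw [Finset.mul_sum]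
      rw [Finset.sum_comm]
      refine Finset.sum_congr rfl fun l _ => ?_
      rw [Finset.sum_comm]
      refine Finset.sum_congr rfl fun m _ => ?_
      simp

theorem lin_mul (hχ : χ ∈ fiber l m) (a b : K) :
    lin χ a * lin χ b = lin χ (a + b) * traceChar K (m * (a * b) + l * (a * b * (a + b))) := by
  rw [lin, lin, lin, ← mem_fiber.1 hχ, ← AddChar.map_add_eq_mul, ← AddChar.map_add_eq_mul]
  congr 1
  ext
  · simp
  · simp
  · simp only [add_c₃, zero_add, add_zero, mul_zero, zero_mul]
    linear_combination (-(a * b * (a + b))) * CharTwo.two_eq_zero (R := K)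

theorem lin_sq (hχ : χ ∈ fiber l m) (a : K) : lin χ a ^ 2 = traceChar K (m * a ^ 2) := by
  rw [pow_two, lin_mul hχ, CharTwo.add_self_eq_zero, lin_zero, mul_zero, mul_zero, add_zero,
    one_mul, pow_two]

/-- Put b = a + s in the double sum: by `lin_mul` the exponent becomes (m + ls)·a(a + s), a
quadratic trace sum in a. -/
theorem sq_sum_lin (hχ : χ ∈ fiber l m) :
    (∑ a, lin χ a) ^ 2 = Fintype.card K *
      ∑ s, if m + l * s = (m + l * s) ^ 2 * s ^ 2 then lin χ s else 0 := by
  rw [pow_two, Finset.sum_mul_sum]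
  have h1 (a : K) : ∑ b, lin χ a * lin χ b =
      ∑ s, lin χ s * traceChar K ((m + l * s) * (a * (a + s))) := by
    rw [← Equiv.sum_comp (Equiv.addLeft a)]
    refine Finset.sum_congr rfl fun s _ => ?_
    rw [Equiv.coe_addLeft, lin_mul hχ, CharTwo.add_cancel_left]
    congr 2
    ring
  rw [Finset.sum_congr rfl fun a _ => h1 a, Finset.sum_comm, Finset.mul_sum]
  refine Finset.sum_congr rfl fun s _ => ?_
  rw [← Finset.mul_sum, sum_traceChar_quadratic]
  split_ifs <;> ring

/-- The constant coefficient b enters through Tr(b(m + la)), so summing over b leaves only a = m/l.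
-/
theorem monicSum_two_eq (hχ : χ ∈ fiber l m) (hl : l ≠ 0) :
    monicSum (charPoly χ) 2 = Fintype.card K * lin χ (m / l) := by
  rw [monicSum_two]
  have h1 (a : K) : ∑ b, χ ⟨a, b, 0⟩ = if a = m / l then Fintype.card K * lin χ a else 0 := by
    have h2 (b : K) : χ ⟨a, b, 0⟩ = lin χ a * traceChar K (b * (m + l * a)) := by
      rw [lin, show b * (m + l * a) = m * b + l * (a * b) by ring, ← mem_fiber.1 hχ,
        ← AddChar.map_add_eq_mul, add_mk_zero', zero_add, zero_add, CharTwo.add_self_eq_zero]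
    simp_rw [h2]
    rw [← Finset.mul_sum, sum_traceChar_mul]
    rw [mul_ite, mul_zero]
    refine if_congr ?_ (mul_comm _ _) rfl
    rw [CharTwo.add_eq_zero, eq_div_iff hl, mul_comm a, eq_comm]
  rw [Finset.sum_congr rfl fun a _ => h1 a, Finset.sum_ite_eq' Finset.univ, if_pos (Finset.mem_univ _)]

theorem add_mem_rad {a b : K} (ha : a ∈ rad l m) (hb : b ∈ rad l m) : a + b ∈ rad l m := by
  rw [mem_rad] at *
  linear_combination ha + hb + (l ^ 2 * (2 * a ^ 3 * b + 3 * a ^ 2 * b ^ 2 + 2 * a * b ^ 3)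
    + m ^ 2 * a * b) * CharTwo.two_eq_zero (R := K)

/-- The defect of additivity is Tr(a(mb + lb²) + lb·a²). With r² = lb it becomes Tr(a(mb + lb² +
r)), and the equation of the radical is the square of mb + lb² + r = 0. -/
theorem lin_add (hχ : χ ∈ fiber l m) (a : K) {b : K} (hb : b ∈ rad l m) :
    lin χ (a + b) = lin χ a * lin χ b := by
  obtain ⟨r, hr⟩ := FiniteField.isSquare_of_char_two
    (ringChar.eq_iff.2 (inferInstance : CharP K 2)) (l * b)
  have h1 : m * b + l * b ^ 2 + r = 0 := by
    refine pow_eq_zero_iff two_ne_zero |>.1 ?_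
    rw [CharTwo.add_sq, CharTwo.add_sq, pow_two r, ← hr]
    linear_combination mem_rad.1 hb
  rw [lin_mul hχ, show m * (a * b) + l * (a * b * (a + b)) =
    a * (m * b + l * b ^ 2) + l * b * a ^ 2 by ring, hr, AddChar.map_add_eq_mul,
    show r * r * a ^ 2 = (r * a) ^ 2 by ring, traceChar_sq, ← AddChar.map_add_eq_mul,
    show a * (m * b + l * b ^ 2) + r * a = a * (m * b + l * b ^ 2 + r) by ring, h1]
  simp

/-- The sum of a character over the radical. -/
def radSum (l m : K) (χ : AddChar (TruncUnit K) ℂ) : ℂ := ∑ b ∈ rad l m, lin χ b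

/-- By `lin_add`, χ restricts to a character of the radical, whose sum is zero or full. -/
theorem radSum_eq (hχ : χ ∈ fiber l m) : radSum l m χ = 0 ∨ radSum l m χ = (rad l m).card := by
  by_cases h : ∀ b ∈ rad l m, lin χ b = 1
  · right
    rw [radSum, Finset.sum_congr rfl h]
    simp
  · left
    push Not at h
    obtain ⟨c, hc, hc1⟩ := h
    have h2 : radSum l m χ * lin χ c = radSum l m χ := by
      rw [radSum, Finset.sum_mul]
      refine Finset.sum_nbij' (fun b => b + c) (fun b => b + c) ?_ ?_ ?_ ?_ ?_
      · intro b hb; exact add_mem_rad hb hc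
      · intro b hb; exact add_mem_rad hb hc
      · intro b _; exact CharTwo.add_cancel_right b c
      · intro b _; exact CharTwo.add_cancel_right b c
      · intro b _; rw [lin_add hχ b hc]
    by_contra h0
    exact hc1 (mul_left_cancel₀ h0 (by rw [h2, mul_one]))

/-- In `sq_sum_lin` the translation s = m/l + b turns the surviving condition into membership of b
in the radical; then `lin_add` splits off the factor χ at m/l. -/
theorem sq_monicSum_one (hχ : χ ∈ fiber l m) (hl : l ≠ 0) :
    monicSum (charPoly χ) 1 ^ 2 = radSum l m χ * monicSum (charPoly χ) 2 := by
  rw [monicSum_one_eq, sq_sum_lin hχ, monicSum_two_eq hχ hl, mul_comm, mul_comm (Fintype.card K : ℂ),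
    ← mul_assoc]
  congr 1
  rw [← Equiv.sum_comp (Equiv.addLeft (m / l)), radSum, rad, Finset.sum_filter, Finset.sum_mul]
  refine Finset.sum_congr rfl fun b _ => ?_
  rw [Equiv.coe_addLeft, ite_mul, zero_mul]
  have h1 : m + l * (m / l + b) = l * b := by
    rw [mul_add, mul_div_cancel₀ _ hl, CharTwo.add_cancel_left]
  have h2 : (l * b) ^ 2 * (m / l + b) ^ 2 = l ^ 2 * b ^ 4 + m ^ 2 * b ^ 2 := by
    rw [CharTwo.add_sq]
    field_simp
    ring
  rw [h1, h2]
  have h3 : l * b = l ^ 2 * b ^ 4 + m ^ 2 * b ^ 2 ↔ l ^ 2 * b ^ 4 + m ^ 2 * b ^ 2 + l * b = 0 := by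
    rw [CharTwo.add_eq_zero, eq_comm]
  by_cases hb : l ^ 2 * b ^ 4 + m ^ 2 * b ^ 2 + l * b = 0
  · rw [if_pos (h3.2 hb), if_pos hb, lin_add hχ _ (mem_rad.2 hb), mul_comm]
  · rw [if_neg (mt h3.1 hb), if_neg hb]

end Fiber

/-! ### Gaussian integers whose square is a power of two times a unit -/

section GaussianInteger

theorem exists_gaussian_sum {ι : Type*} (s : Finset ι) (f : ι → ℂ)
    (hf : ∀ i ∈ s, f i ^ 2 = 1 ∨ f i ^ 2 = -1) :
    ∃ x y : ℤ, ∑ i ∈ s, f i = x + y * Complex.I := by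
  classical
  induction s using Finset.induction_on with
  | empty => exact ⟨0, 0, by simp⟩
  | insert i s hi ih =>
    obtain ⟨x, y, hxy⟩ := ih fun j hj => hf j (by simp [hj])
    rw [Finset.sum_insert hi, hxy]
    rcases hf i (by simp) with h | h
    · rcases mul_self_eq_one_iff.1 ((pow_two _).symm.trans h) with h | h
      · exact ⟨x + 1, y, by rw [h]; push_cast; ring⟩
      · exact ⟨x - 1, y, by rw [h]; push_cast; ring⟩
    · rw [← Complex.I_sq, sq_eq_sq_iff_eq_or_eq_neg] at h
      rcases h with h | h
      · exact ⟨x, y + 1, by rw [h]; push_cast; ring⟩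
      · exact ⟨x, y - 1, by rw [h]; push_cast; ring⟩

theorem exists_natAbs_eq_two_pow {x : ℤ} {N : ℕ} (h : x ∣ 2 ^ N) : ∃ i, x ^ 2 = 2 ^ (2 * i) := by
  have h1 : x.natAbs ∣ 2 ^ N := by
    have := Int.natAbs_dvd_natAbs.2 h
    rwa [Int.natAbs_pow] at this
  obtain ⟨i, -, hi⟩ := (Nat.dvd_prime_pow Nat.prime_two).1 h1
  refine ⟨i, ?_⟩
  rw [← Int.natAbs_sq, hi]
  push_cast
  ring

theorem even_of_sq_eq_two_pow {x : ℤ} {N : ℕ} (h : x ^ 2 = 2 ^ N) : Even N := by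
  obtain ⟨i, hi⟩ := exists_natAbs_eq_two_pow (h ▸ dvd_pow_self x two_ne_zero)
  rw [h] at hi
  have : N = 2 * i := Int.pow_right_injective (by norm_num) hi
  exact this ▸ even_two_mul i

theorem odd_of_two_mul_sq_eq_two_pow {x : ℤ} {N : ℕ} (h : 2 * x ^ 2 = 2 ^ N) : Odd N := by
  obtain ⟨i, hi⟩ := exists_natAbs_eq_two_pow (N := N)
    (h ▸ (dvd_pow_self x two_ne_zero).mul_left 2)
  rw [hi, ← pow_succ'] at h
  have : 2 * i + 1 = N := Int.pow_right_injective (by norm_num) h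
  exact this ▸ odd_two_mul_add_one i

/-- If `2^N κ` is the square of a Gaussian integer, where `κ² = ±1`, then `κ² = (-1)^N`. -/
theorem sq_eq_neg_one_pow {x y : ℤ} {N : ℕ} {κ : ℂ} (h : (x + y * Complex.I) ^ 2 = 2 ^ N * κ)
    (hκ : κ ^ 2 = 1 ∨ κ ^ 2 = -1) : κ ^ 2 = (-1) ^ N := by
  have hexp : ((x : ℂ) + y * Complex.I) ^ 2 =
      ((x ^ 2 - y ^ 2 : ℤ) : ℂ) + ((2 * x * y : ℤ) : ℂ) * Complex.I := by
    push_cast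
    linear_combination (y : ℂ) ^ 2 * Complex.I_sq
  have key (u v : ℤ) (h' : ((x : ℂ) + y * Complex.I) ^ 2 = (u : ℂ) + (v : ℂ) * Complex.I) :
      x ^ 2 - y ^ 2 = u ∧ 2 * x * y = v := by
    rw [hexp] at h'
    have hre := congrArg Complex.re h'
    have him := congrArg Complex.im h'
    simp only [Complex.add_re, Complex.mul_re, Complex.intCast_re, Complex.intCast_im, Complex.I_re,
      Complex.I_im, Complex.add_im, Complex.mul_im] at hre him
    constructor
    · have : ((x ^ 2 - y ^ 2 : ℤ) : ℝ) = u := by linarith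
      exact_mod_cast this
    · have : ((2 * x * y : ℤ) : ℝ) = v := by linarith
      exact_mod_cast this
  rcases hκ with h1 | h1
  -- κ = ±1: the imaginary part 2xy vanishes, so 2^N is x² or y².
  · have hN : Even N := by
      rcases mul_self_eq_one_iff.1 ((pow_two _).symm.trans h1) with rfl | rfl
      · obtain ⟨ha, hb⟩ := key (2 ^ N) 0 (by rw [h]; push_cast; ring)
        have : x = 0 ∨ y = 0 := by simpa using hb
        rcases this with rfl | rfl
        · have : (0 : ℤ) < 2 ^ N := by positivity
          nlinarith [sq_nonneg y]
        · exact even_of_sq_eq_two_pow (x := x) (by linarith)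
      · obtain ⟨ha, hb⟩ := key (-2 ^ N) 0 (by rw [h]; push_cast; ring)
        have : x = 0 ∨ y = 0 := by simpa using hb
        rcases this with rfl | rfl
        · exact even_of_sq_eq_two_pow (x := y) (by linarith)
        · have : (0 : ℤ) < 2 ^ N := by positivity
          nlinarith [sq_nonneg x]
    rw [h1, hN.neg_one_pow]
  -- κ = ±i: the real part vanishes, so x = ±y and 2^N = 2x².
  · have hN : Odd N := by
      have h2 := h1
      rw [← Complex.I_sq, sq_eq_sq_iff_eq_or_eq_neg] at h2
      have hxy (hd : x ^ 2 - y ^ 2 = 0) (hs : 2 * x * y = 2 ^ N ∨ 2 * x * y = -2 ^ N) :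
          Odd N := by
        have hpos : (0 : ℤ) < 2 ^ N := by positivity
        rcases sq_eq_sq_iff_eq_or_eq_neg.1 (sub_eq_zero.1 hd) with rfl | rfl
        · refine odd_of_two_mul_sq_eq_two_pow (x := x) ?_
          rcases hs with hs | hs
          · linarith
          · nlinarith [sq_nonneg x]
        · refine odd_of_two_mul_sq_eq_two_pow (x := y) ?_
          rcases hs with hs | hs
          · nlinarith [sq_nonneg y]
          · linarith
      rcases h2 with rfl | rfl
      · obtain ⟨ha, hb⟩ := key 0 (2 ^ N) (by rw [h]; push_cast; ring)
        exact hxy ha (Or.inl hb)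
      · obtain ⟨ha, hb⟩ := key 0 (-2 ^ N) (by rw [h]; push_cast; ring)
        exact hxy ha (Or.inr hb)
    rw [h1, hN.neg_one_pow]

end GaussianInteger

/-! ### Power sums averaged over a fiber -/

section Evaluation
variable {K : Type*} [Field K] {l m : K}

theorem center_eq (hl : l ≠ 0) : m * (m / l) ^ 2 = m ^ 3 / l ^ 2 := by
  field_simp

variable [Fintype K] {χ : AddChar (TruncUnit K) ℂ}

theorem rad_card_ne_zero (l m : K) : ((rad l m).card : ℂ) ≠ 0 :=
  Nat.cast_ne_zero.2 (Finset.card_ne_zero_of_mem zero_mem_rad)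

variable [CharP K 2]

theorem exists_traceChar_mul_ne_one (hl : l ≠ 0) : ∃ c : K, traceChar K (l * c) ≠ 1 := by
  obtain ⟨x, hx⟩ := AddChar.ne_one_iff.1 (traceChar_ne_one (K := K))
  exact ⟨x / l, by rwa [mul_div_cancel₀ _ hl]⟩

theorem monicSum_eq_zero_of_fiber (hχ : χ ∈ fiber l m) (hl : l ≠ 0) (n : ℕ) (hn : 3 ≤ n) :
    monicSum (charPoly χ) n = 0 := by
  obtain ⟨c, hc⟩ := exists_traceChar_mul_ne_one hl
  refine monicSum_eq_zero_of_three (c := c) ?_ hn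
  rwa [mem_fiber.1 hχ, mul_zero, zero_add]

theorem monicSum_eq_zero_of_fiber_zero (hχ : χ ∈ fiber 0 m) (hm : m ≠ 0) (n : ℕ) (hn : 2 ≤ n) :
    monicSum (charPoly χ) n = 0 := by
  obtain ⟨c, hc⟩ := exists_traceChar_mul_ne_one hm
  refine monicSum_eq_zero_of_two (fun v => ?_) (c := c) ?_ hn
  · simp [mem_fiber.1 hχ]
  · rwa [mem_fiber.1 hχ, mul_zero, add_zero]

theorem monicSum_eq_zero_of_fiber_zero_zero (hχ : χ ∈ fiber (0 : K) 0) (h0 : χ ≠ 0) (n : ℕ)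
    (hn : 1 ≤ n) : monicSum (charPoly χ) n = 0 := by
  have h2 (u v : K) : χ ⟨0, u, v⟩ = 1 := by simp [mem_fiber.1 hχ]
  obtain ⟨g, hg⟩ := AddChar.ne_zero_iff.1 h0
  refine monicSum_eq_zero_of_one h2 (c := g.c₁) ?_ hn
  have : g = ⟨g.c₁, 0, 0⟩ + ⟨0, g.c₂, g.c₃ - g.c₁ * g.c₂⟩ := by ext <;> simp
  rwa [this, AddChar.map_add_eq_mul, h2, mul_one] at hg

theorem sum_fiber_zero_zero {n : ℕ} (hn : 1 ≤ n) :
    ∑ χ ∈ fiber (0 : K) 0, primePowerSum (charPoly χ) n = primePowerSum (charPoly (K := K) 0) n := by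
  refine Finset.sum_eq_single 0 (fun χ hχ h0 => ?_) fun h => absurd ?_ h
  · obtain ⟨k, rfl⟩ := Nat.exists_eq_add_of_le' hn
    exact primePowerSum_eq_zero (monicSum_eq_zero_of_fiber_zero_zero hχ h0) k
  · simp [mem_fiber]

section Moments
variable [DecidableEq K]

theorem sum_lin (l m a : K) :
    ∑ χ ∈ fiber l m, lin χ a = if a = 0 then (Fintype.card K : ℂ) else 0 := by
  have := sum_fiber l m ⟨a, 0, 0⟩
  simpa [lin] using this

theorem card_fiber (l m : K) : ((fiber l m).card : ℂ) = Fintype.card K := by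
  have := sum_lin l m 0
  simpa [lin_zero] using this

theorem sum_lin_mul_lin (l m a b : K) :
    ∑ χ ∈ fiber l m, lin χ a * lin χ b =
      if a = b then Fintype.card K * traceChar K (m * b ^ 2) else 0 := by
  rw [Finset.sum_congr rfl fun χ hχ => lin_mul hχ a b, ← Finset.sum_mul, sum_lin, ite_mul, zero_mul]
  simp_rw [CharTwo.add_eq_zero]
  refine ite_congr rfl (fun h => ?_) fun _ => rfl
  rw [h, CharTwo.add_self_eq_zero, mul_zero, mul_zero, add_zero, pow_two]

theorem sum_lin_pow_even (l m a : K) (i : ℕ) :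
    ∑ χ ∈ fiber l m, lin χ a ^ (2 * i) = Fintype.card K * traceChar K (m * a ^ 2) ^ i := by
  rw [Finset.sum_congr rfl fun χ hχ => by rw [pow_mul, lin_sq hχ], Finset.sum_const, nsmul_eq_mul,
    card_fiber]

theorem sum_lin_pow_odd (l m a : K) (i : ℕ) :
    ∑ χ ∈ fiber l m, lin χ a ^ (2 * i + 1) = if a = 0 then (Fintype.card K : ℂ) else 0 := by
  rw [Finset.sum_congr rfl fun χ hχ => by rw [pow_succ, pow_mul, lin_sq hχ], ← Finset.mul_sum,
    sum_lin, mul_ite, mul_zero]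
  refine ite_congr rfl (fun h => ?_) fun _ => rfl
  simp [h]

/-- Even powers of χ at a are constant on the fiber by `lin_sq`. What is left of the Gauss sum is
the term b = 0 for k even and b = a for k odd; the latter brings one more trace factor, whence the
floor of (k + 1)/2. -/
theorem sum_monicSum_mul_pow (l m a : K) (k : ℕ) :
    ∑ χ ∈ fiber l m, monicSum (charPoly χ) 1 * lin χ a ^ k =
      Fintype.card K * traceChar K (m * a ^ 2) ^ ((k + 1) / 2) := by
  obtain ⟨i, rfl | rfl⟩ := Nat.even_or_odd' k
  · rw [Finset.sum_congr rfl fun χ hχ => by rw [pow_mul, lin_sq hχ, monicSum_one_eq],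
      ← Finset.sum_mul, Finset.sum_comm, show (2 * i + 1) / 2 = i by omega]
    simp [sum_lin]
  · rw [Finset.sum_congr rfl fun χ hχ => by
      rw [pow_succ, pow_mul, lin_sq hχ, monicSum_one_eq, mul_left_comm, Finset.sum_mul],
      ← Finset.mul_sum, Finset.sum_comm, show (2 * i + 1 + 1) / 2 = i + 1 by omega]
    simp_rw [sum_lin_mul_lin]
    simp
    ring

end Moments

theorem sum_radSum (l m : K) : ∑ χ ∈ fiber l m, radSum l m χ = Fintype.card K := by
  classical
  simp_rw [radSum]
  rw [Finset.sum_comm]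
  simp [sum_lin, zero_mem_rad]

theorem center_mem_rad (hl : l ≠ 0) : m / l ∈ rad l m ↔ m = 0 := by
  rw [mem_rad]
  have : l ^ 2 * (m / l) ^ 4 + m ^ 2 * (m / l) ^ 2 + l * (m / l) = m := by
    have h : l ^ 2 * (m / l) ^ 4 = m ^ 2 * (m / l) ^ 2 := by field_simp
    rw [h, CharTwo.add_self_eq_zero, zero_add, mul_div_cancel₀ _ hl]
  rw [this]

theorem sum_lin_mul_radSum [DecidableEq K] (hl : l ≠ 0) :
    ∑ χ ∈ fiber l m, lin χ (m / l) * radSum l m χ =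
      if m = 0 then (Fintype.card K : ℂ) else 0 := by
  have h1 : ∀ χ ∈ fiber l m, lin χ (m / l) * radSum l m χ = ∑ b ∈ rad l m, lin χ (m / l + b) := by
    intro χ hχ
    rw [radSum, Finset.mul_sum]
    exact Finset.sum_congr rfl fun b hb => (lin_add hχ _ hb).symm
  rw [Finset.sum_congr rfl h1, Finset.sum_comm]
  simp_rw [sum_lin, CharTwo.add_eq_zero]
  rw [Finset.sum_ite_eq]
  exact if_congr (center_mem_rad hl) rfl rfl

/-- If the sum over the radical is 0, then c₁ = 0 and the odd power sum, a multiple of c₁, vanishes;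
so the formula with R = |rad| is valid for every χ in the fiber. -/
theorem sum_fiber_odd (hl : l ≠ 0) (k : ℕ) :
    ∑ χ ∈ fiber l m, primePowerSum (charPoly χ) (2 * k + 1) =
      (Fintype.card K : ℂ) ^ (k + 1) * traceChar K (m ^ 3 / l ^ 2) ^ ((k + 1) / 2) *
        (lucasPair (rad l m).card k).2 := by
  classical
  have h1 : ∀ χ ∈ fiber l m, primePowerSum (charPoly χ) (2 * k + 1) =
      (Fintype.card K : ℂ) ^ k * (lucasPair (rad l m).card k).2 *
        (monicSum (charPoly χ) 1 * lin χ (m / l) ^ k) := by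
    intro χ hχ
    have h3 := monicSum_eq_zero_of_fiber hχ hl
    have hsq := sq_monicSum_one hχ hl
    rcases radSum_eq hχ with h | h
    · rw [h] at hsq
      have h0 : monicSum (charPoly χ) 1 = 0 := by simpa using hsq
      rw [(primePowerSum_eq_lucasPair h3 (R := 0) (by rw [hsq]; simp) k).1, h0]
      simp
    · rw [(primePowerSum_eq_lucasPair h3 (R := (rad l m).card) (by rw [hsq, h]; simp) k).1,
        monicSum_two_eq hχ hl]
      ring
  rw [Finset.sum_congr rfl h1, ← Finset.mul_sum, sum_monicSum_mul_pow, center_eq hl]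
  ring

/-- Interpolates linearly in the radical sum between its two values 0 and |rad|, so that averaging
over the fiber needs only first moments. -/
theorem primePowerSum_even_eq (hχ : χ ∈ fiber l m) (hl : l ≠ 0) (k : ℕ) :
    primePowerSum (charPoly χ) (2 * k + 2) = -((Fintype.card K : ℂ) ^ (k + 1) *
      (2 * (-1) ^ (k + 1) * lin χ (m / l) ^ (k + 1) +
        ((lucasPair (rad l m).card (k + 1)).1 - 2 * (-1) ^ (k + 1)) / (rad l m).card *
          (lin χ (m / l) ^ (k + 1) * radSum l m χ))) := by
  have h3 := monicSum_eq_zero_of_fiber hχ hl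
  have hsq := sq_monicSum_one hχ hl
  have hM := rad_card_ne_zero l m
  rcases radSum_eq hχ with h | h
  · rw [h] at hsq
    rw [(primePowerSum_eq_lucasPair h3 (R := 0) (by rw [hsq]; simp) k).2, lucasPair_zero_fst, h,
      monicSum_two_eq hχ hl]
    push_cast
    ring
  · rw [(primePowerSum_eq_lucasPair h3 (R := (rad l m).card) (by rw [hsq, h]; simp) k).2, h,
      monicSum_two_eq hχ hl]
    field_simp
    ring

theorem sum_fiber_four_mul (hl : l ≠ 0) {i : ℕ} (hi : 1 ≤ i) :
    ∑ χ ∈ fiber l m, primePowerSum (charPoly χ) (4 * i) =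
      -((Fintype.card K : ℂ) ^ (2 * i + 1) * traceChar K (m ^ 3 / l ^ 2) ^ i *
        (2 + ((lucasPair (rad l m).card (2 * i)).1 - 2) / (rad l m).card)) := by
  classical
  obtain ⟨k, hk⟩ : ∃ k, 2 * i = k + 1 := ⟨2 * i - 1, by omega⟩
  have h1 : ∀ χ ∈ fiber l m, lin χ (m / l) ^ (2 * i) = traceChar K (m ^ 3 / l ^ 2) ^ i := by
    intro χ hχ
    rw [pow_mul, lin_sq hχ, center_eq hl]
  rw [show 4 * i = 2 * k + 2 by omega, Finset.sum_congr rfl fun χ hχ => by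
    rw [primePowerSum_even_eq hχ hl, ← hk, h1 χ hχ, pow_mul (-1 : ℂ), neg_one_sq, one_pow],
    Finset.sum_neg_distrib, ← Finset.mul_sum, Finset.sum_add_distrib, ← Finset.mul_sum,
    ← Finset.mul_sum, ← Finset.mul_sum, sum_radSum, Finset.sum_const, nsmul_eq_mul, card_fiber]
  ring

/-- An odd power of χ at m/l averages to zero unless m/l = 0; against the radical sum it does so
unless m/l lies in the radical, which again means m = 0. -/
theorem sum_fiber_four_mul_add_two [DecidableEq K] (hl : l ≠ 0) (i : ℕ) :
    ∑ χ ∈ fiber l m, primePowerSum (charPoly χ) (4 * i + 2) = if m = 0 then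
      -((Fintype.card K : ℂ) ^ (2 * i + 2) *
        (-2 + ((lucasPair (rad l m).card (2 * i + 1)).1 + 2) / (rad l m).card)) else 0 := by
  have h1 : ∑ χ ∈ fiber l m, lin χ (m / l) ^ (2 * i + 1) * radSum l m χ =
      if m = 0 then (Fintype.card K : ℂ) else 0 := by
    rw [Finset.sum_congr rfl fun χ hχ => by
      rw [pow_succ, pow_mul, lin_sq hχ, center_eq hl, mul_assoc], ← Finset.mul_sum,
      sum_lin_mul_radSum hl, mul_ite, mul_zero]
    refine ite_congr rfl (fun h => ?_) fun _ => rfl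
    simp [h]
  have h2 : (-1 : ℂ) ^ (2 * i + 1) = -1 := by rw [pow_succ, pow_mul]; simp
  rw [show 4 * i + 2 = 2 * (2 * i) + 2 by ring, Finset.sum_congr rfl fun χ hχ => by
    rw [primePowerSum_even_eq hχ hl, h2],
    Finset.sum_neg_distrib, ← Finset.mul_sum, Finset.sum_add_distrib, ← Finset.mul_sum,
    ← Finset.mul_sum, h1, sum_lin_pow_odd]
  simp only [div_eq_zero_iff, hl, or_false]
  split_ifs
  · ring
  · ring

/-- For l = 0 the condition in `sq_sum_lin` reads m = m²s², with the unique solution s = the square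
root of 1/m. -/
theorem exists_center (hm : m ≠ 0) : ∃ s : K, s ≠ 0 ∧ m * s ^ 2 = 1 ∧
    ∀ χ ∈ fiber 0 m, monicSum (charPoly χ) 1 ^ 2 = Fintype.card K * lin χ s := by
  classical
  obtain ⟨s, hs⟩ := FiniteField.isSquare_of_char_two
    (ringChar.eq_iff.2 (inferInstance : CharP K 2)) m⁻¹
  have hms : m * s ^ 2 = 1 := by rw [pow_two, ← hs, mul_inv_cancel₀ hm]
  refine ⟨s, ?_, hms, fun χ hχ => ?_⟩
  · rintro rfl
    simp at hms
  · rw [monicSum_one_eq, sq_sum_lin hχ]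
    have h (x : K) : m + 0 * x = (m + 0 * x) ^ 2 * x ^ 2 ↔ x = s := by
      rw [zero_mul, add_zero]
      constructor
      · intro h
        have h1 : m * (m * x ^ 2) = m * (m * s ^ 2) := by rw [hms]; linear_combination -h
        exact CharTwo.sq_inj.1 (mul_left_cancel₀ hm (mul_left_cancel₀ hm h1))
      · rintro rfl
        linear_combination -m * hms
    simp_rw [h]
    simp

theorem sum_fiber_zero_odd (hm : m ≠ 0) (k : ℕ) :
    ∑ χ ∈ fiber 0 m, primePowerSum (charPoly χ) (2 * k + 1) =
      (Fintype.card K : ℂ) ^ (k + 1) * traceChar K 1 ^ ((k + 1) / 2) := by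
  classical
  obtain ⟨s, -, hms, hs⟩ := exists_center hm
  have h1 : ∀ χ ∈ fiber 0 m, primePowerSum (charPoly χ) (2 * k + 1) =
      (Fintype.card K : ℂ) ^ k * (monicSum (charPoly χ) 1 * lin χ s ^ k) := by
    intro χ hχ
    rw [primePowerSum_eq_pow (monicSum_eq_zero_of_fiber_zero hχ hm), pow_succ, pow_mul, neg_sq,
      hs χ hχ]
    ring
  rw [Finset.sum_congr rfl h1, ← Finset.mul_sum, sum_monicSum_mul_pow, hms]
  ring

theorem primePowerSum_two_mul {s : K} (hm : m ≠ 0) (hχ : χ ∈ fiber 0 m)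
    (hs : monicSum (charPoly χ) 1 ^ 2 = Fintype.card K * lin χ s) {j : ℕ} (hj : 1 ≤ j) :
    primePowerSum (charPoly χ) (2 * j) = -((Fintype.card K : ℂ) ^ j * lin χ s ^ j) := by
  obtain ⟨k, hk⟩ : ∃ k, 2 * j = k + 1 := ⟨2 * j - 1, by omega⟩
  rw [hk, primePowerSum_eq_pow (monicSum_eq_zero_of_fiber_zero hχ hm), ← hk, pow_mul, neg_sq, hs,
    mul_pow]

theorem sum_fiber_zero_four_mul (hm : m ≠ 0) {i : ℕ} (hi : 1 ≤ i) :
    ∑ χ ∈ fiber 0 m, primePowerSum (charPoly χ) (4 * i) =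
      -((Fintype.card K : ℂ) ^ (2 * i + 1) * traceChar K 1 ^ i) := by
  classical
  obtain ⟨s, -, hms, hs⟩ := exists_center hm
  rw [show 4 * i = 2 * (2 * i) by ring, Finset.sum_congr rfl fun χ hχ =>
    primePowerSum_two_mul hm hχ (hs χ hχ) (by omega), Finset.sum_neg_distrib, ← Finset.mul_sum,
    sum_lin_pow_even, hms]
  ring

theorem sum_fiber_zero_four_mul_add_two (hm : m ≠ 0) (i : ℕ) :
    ∑ χ ∈ fiber 0 m, primePowerSum (charPoly χ) (4 * i + 2) = 0 := by
  classical
  obtain ⟨s, hs0, -, hs⟩ := exists_center hm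
  rw [show 4 * i + 2 = 2 * (2 * i + 1) by ring, Finset.sum_congr rfl fun χ hχ =>
    primePowerSum_two_mul hm hχ (hs χ hχ) (by omega), Finset.sum_neg_distrib, ← Finset.mul_sum,
    sum_lin_pow_odd, if_neg hs0, mul_zero, neg_zero]

/-! ### Parity constraints and the order of the radical -/

section Parity
variable {r : ℕ}

theorem lin_sq_eq_or (hχ : χ ∈ fiber l m) (a : K) : lin χ a ^ 2 = 1 ∨ lin χ a ^ 2 = -1 := by
  rw [lin_sq hχ]
  exact traceChar_eq_or _

/-- For l = 0 and m = 1 the Gauss sum is a Gaussian integer with square 2^r κ, where κ² = (-1)^{Tr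
1}; `sq_eq_neg_one_pow` reads off the trace. -/
theorem traceChar_one (hr : Fintype.card K = 2 ^ r) : traceChar K 1 = (-1) ^ r := by
  classical
  obtain ⟨s, -, hms, hs⟩ := exists_center (one_ne_zero (α := K))
  have hne : (fiber (0 : K) 1).Nonempty := by
    rw [← Finset.card_ne_zero, ← Nat.cast_ne_zero (R := ℂ), card_fiber]
    simp
  obtain ⟨χ, hχ⟩ := hne
  obtain ⟨x, y, hxy⟩ := exists_gaussian_sum Finset.univ (lin χ) fun a _ => lin_sq_eq_or hχ a
  have h := hs χ hχ
  rw [monicSum_one_eq, hxy, hr] at h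
  push_cast at h
  rw [← sq_eq_neg_one_pow h (lin_sq_eq_or hχ s), lin_sq hχ, hms]

/-- The radical sums over the fiber add up to q, so some χ has a nonzero one. For it c₁² = 2^{r+j} κ
with κ² = (-1)^{Tr(m³/l²)}. -/
theorem traceChar_center (hr : Fintype.card K = 2 ^ r) (hl : l ≠ 0) {j : ℕ}
    (hj : (rad l m).card = 2 ^ j) : traceChar K (m ^ 3 / l ^ 2) = (-1) ^ (r + j) := by
  have hne : ∃ χ ∈ fiber l m, radSum l m χ ≠ 0 := by
    refine Finset.exists_ne_zero_of_sum_ne_zero ?_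
    rw [sum_radSum]
    simp
  obtain ⟨χ, hχ, h0⟩ := hne
  obtain ⟨x, y, hxy⟩ := exists_gaussian_sum Finset.univ (lin χ) fun a _ => lin_sq_eq_or hχ a
  have h := sq_monicSum_one hχ hl
  rw [(radSum_eq hχ).resolve_left h0, monicSum_two_eq hχ hl, monicSum_one_eq, hxy, hr, hj,
    ← mul_assoc] at h
  push_cast at h
  rw [← pow_add, add_comm j] at h
  rw [← sq_eq_neg_one_pow h (lin_sq_eq_or hχ _), lin_sq hχ, center_eq hl]

/-- The radical is an additive subgroup of K, so its order is a power of two, and it consists of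
roots of a quartic. -/
theorem card_rad (hl : l ≠ 0) :
    (rad l m).card = 1 ∨ (rad l m).card = 2 ∨ (rad l m).card = 4 := by
  classical
  let S : AddSubgroup K :=
    { carrier := rad l m
      add_mem' := fun ha hb => add_mem_rad ha hb
      zero_mem' := zero_mem_rad
      neg_mem' := fun {x} hx => by rwa [CharTwo.neg_eq] }
  have hcard : Nat.card S = (rad l m).card := by
    change Nat.card (rad l m : Set K) = _
    simp
  obtain ⟨r, -, hr⟩ := FiniteField.card K 2
  have hdvd : (rad l m).card ∣ 2 ^ (r : ℕ) := by
    rw [← hcard, ← hr, ← Nat.card_eq_fintype_card]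
    exact S.card_addSubgroup_dvd_card
  obtain ⟨j, -, hj⟩ := (Nat.dvd_prime_pow Nat.prime_two).1 hdvd
  have hle : (rad l m).card ≤ 4 := by
    set p : K[X] := C (l ^ 2) * X ^ 4 + C (m ^ 2) * X ^ 2 + C l * X with hp
    have hp0 : p ≠ 0 := by
      intro h
      have := congrArg (coeff · 1) h
      simp only [hp, coeff_add, coeff_C_mul, coeff_X_pow, coeff_X, coeff_zero] at this
      norm_num at this
      exact hl this
    have hsub : rad l m ⊆ p.roots.toFinset := by
      intro b hb
      rw [Multiset.mem_toFinset, mem_roots hp0]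
      simpa [hp] using mem_rad.1 hb
    calc (rad l m).card ≤ p.roots.toFinset.card := Finset.card_le_card hsub
      _ ≤ Multiset.card p.roots := Multiset.toFinset_card_le _
      _ ≤ p.natDegree := card_roots' p
      _ ≤ 4 := by rw [hp]; compute_degree
  rw [hj] at hle ⊢
  have : j ≤ 2 := (Nat.pow_le_pow_iff_right (by norm_num)).1 (show 2 ^ j ≤ 2 ^ 2 from hle)
  interval_cases j <;> simp

end Parity
end Evaluation

/-! ### Distribution of the order of the radical -/

section Counting
open scoped Classical
variable {K : Type*} [Field K] [Fintype K]

/-- Double counting: b = 0 lies in every radical, and for b ≠ 0 exactly one m works because square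
roots are unique. -/
theorem sum_card_rad [CharP K 2] (l : K) :
    ∑ m : K, ((rad l m).card : ℂ) = 2 * Fintype.card K - 1 := by
  have h1 (m : K) : ((rad l m).card : ℂ) = ∑ b, if b ∈ rad l m then 1 else 0 := by simp
  simp_rw [h1]
  rw [Finset.sum_comm, ← Finset.add_sum_erase _ _ (Finset.mem_univ (0 : K))]
  have h2 : ∀ b ∈ Finset.univ.erase (0 : K), ∑ m, (if b ∈ rad l m then (1 : ℂ) else 0) = 1 := by
    intro b hb
    have hb0 : b ≠ 0 := Finset.ne_of_mem_erase hb
    obtain ⟨s, hs⟩ := FiniteField.isSquare_of_char_two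
      (ringChar.eq_iff.2 (inferInstance : CharP K 2)) (l ^ 2 * b ^ 4 + l * b)
    have h3 (m : K) : b ∈ rad l m ↔ m = s / b := by
      rw [mem_rad, eq_div_iff hb0, ← CharTwo.sq_inj (x := m * b), mul_pow, pow_two s, ← hs]
      have h2 := CharTwo.two_eq_zero (R := K)
      constructor <;> intro h
      · linear_combination h - (l ^ 2 * b ^ 4 + l * b) * h2
      · linear_combination h + (l ^ 2 * b ^ 4 + l * b) * h2
    simp [h3]
  rw [Finset.sum_congr rfl h2]
  simp [zero_mem_rad, Finset.card_erase_of_mem, Nat.cast_sub Fintype.card_pos]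
  ring

/-- For m = 0 and b ≠ 0 the equation reduces to l b³ = 1, with exactly one l. -/
theorem sum_card_rad_zero [CharP K 2] :
    ∑ l ∈ Finset.univ.erase (0 : K), ((rad l 0).card : ℂ) = 2 * (Fintype.card K - 1) := by
  have h1 (l : K) : ((rad l 0).card : ℂ) = ∑ b, if b ∈ rad l 0 then 1 else 0 := by simp
  simp_rw [h1]
  rw [Finset.sum_comm, ← Finset.add_sum_erase _ _ (Finset.mem_univ (0 : K))]
  have h2 : ∀ b ∈ Finset.univ.erase (0 : K),
      ∑ l ∈ Finset.univ.erase (0 : K), (if b ∈ rad l 0 then (1 : ℂ) else 0) = 1 := by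
    intro b hb
    have hb0 : b ≠ 0 := Finset.ne_of_mem_erase hb
    rw [Finset.sum_eq_single_of_mem (b ^ 3)⁻¹ (by simp [hb0])]
    · rw [if_pos]
      rw [mem_rad]
      have : ((b ^ 3)⁻¹) ^ 2 * b ^ 4 = (b ^ 3)⁻¹ * b := by field_simp
      rw [this, add_right_comm, CharTwo.add_self_eq_zero]
      simp
    · intro l hl hne
      have hl0 : l ≠ 0 := Finset.ne_of_mem_erase hl
      refine if_neg fun h => hne ?_
      rw [mem_rad] at h
      have h2 : l * b * (l * b ^ 3 + 1) = 0 := by linear_combination h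
      have h3 := (mul_eq_zero.1 h2).resolve_left (mul_ne_zero hl0 hb0)
      exact eq_inv_of_mul_eq_one_left (CharTwo.add_eq_zero.1 h3)
  rw [Finset.sum_congr rfl h2]
  simp [zero_mem_rad, Finset.card_erase_of_mem, Nat.cast_sub Fintype.card_pos]
  ring

theorem card_erase_zero : ((Finset.univ.erase (0 : K)).card : ℂ) = Fintype.card K - 1 := by
  rw [Finset.card_erase_of_mem (Finset.mem_univ _), Finset.card_univ, Nat.cast_pred Fintype.card_pos]

variable [CharP K 2]

/-- m = 0 gives q - 1. For m ≠ 0, replacing l by its inverse gives a full quadratic sum, which is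
zero, without its term 1 at l = 0; hence -1. -/
theorem sum_traceChar_center :
    ∑ l ∈ Finset.univ.erase (0 : K), ∑ m : K, traceChar K (m ^ 3 / l ^ 2) = 0 := by
  rw [Finset.sum_comm, ← Finset.add_sum_erase _ _ (Finset.mem_univ (0 : K))]
  have h : ∀ m ∈ Finset.univ.erase (0 : K),
      ∑ l ∈ Finset.univ.erase (0 : K), traceChar K (m ^ 3 / l ^ 2) = -1 := by
    intro m hm
    have h1 : ∑ l ∈ Finset.univ.erase (0 : K), traceChar K (m ^ 3 / l ^ 2) =
        ∑ l ∈ Finset.univ.erase (0 : K), traceChar K (m ^ 3 * l ^ 2) := by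
      refine Finset.sum_nbij' (fun l => l⁻¹) (fun l => l⁻¹) ?_ ?_ ?_ ?_ ?_ <;> intro l hl
      · simpa using hl
      · simpa using hl
      · simp
      · simp
      · rw [div_eq_mul_inv, inv_pow]
    have h2 := sum_traceChar_quadratic (m ^ 3) 0
    rw [if_neg (by simpa using Finset.ne_of_mem_erase hm),
      ← Finset.add_sum_erase _ _ (Finset.mem_univ (0 : K))] at h2
    simp only [add_zero, ← pow_two] at h2
    rw [zero_pow two_ne_zero, mul_zero, AddChar.map_zero_eq_one] at h2
    rw [h1]
    linear_combination h2
  rw [Finset.sum_congr rfl h]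
  simp only [ne_eq, OfNat.ofNat_ne_zero, not_false_eq_true, zero_pow, zero_div,
    AddChar.map_zero_eq_one, Finset.sum_const, nsmul_eq_mul, card_erase_zero]
  ring

variable {r : ℕ}

theorem traceChar_center_eq (hr : Fintype.card K = 2 ^ r) {l m : K} (hl : l ≠ 0) :
    traceChar K (m ^ 3 / l ^ 2) = (if (rad l m).card = 2 then -1 else 1) * (-1) ^ r := by
  rcases card_rad (m := m) hl with h | h | h
  · rw [traceChar_center hr hl (j := 0) (by rw [h]; rfl), h]
    simp
  · rw [traceChar_center hr hl (j := 1) (by rw [h]; rfl), h, pow_succ]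
    simp
  · rw [traceChar_center hr hl (j := 2) (by rw [h]; rfl), h, pow_add]
    simp

/-- The distribution of the size of the radical. -/
theorem sum_rad (hr : Fintype.card K = 2 ^ r) (G : ℕ → ℂ) :
    ∑ l ∈ Finset.univ.erase (0 : K), ∑ m : K, G (rad l m).card =
      (Fintype.card K - 1) * ((Fintype.card K + 1) / 3 * G 1 + Fintype.card K / 2 * G 2 +
        (Fintype.card K - 2) / 6 * G 4) := by
  -- On {1, 2, 4} every function is a combination of 1, M and the sign that is -1 only at M = 2; the
  -- coefficients come from interpolation, and all three sums are known.
  have hG : ∀ l ∈ Finset.univ.erase (0 : K), ∑ m : K, G (rad l m).card =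
      ∑ m : K, ((2 * G 1 + G 2 - G 4) / 2 + (G 4 - G 1) / 3 * (rad l m).card +
        (G 1 - (2 * G 1 + G 2 - G 4) / 2 - (G 4 - G 1) / 3) * (-1) ^ r *
          traceChar K (m ^ 3 / l ^ 2)) := by
    intro l hl
    have hl0 := Finset.ne_of_mem_erase hl
    refine Finset.sum_congr rfl fun m _ => ?_
    have h2 : ((-1 : ℂ) ^ r) * (-1) ^ r = 1 := by rw [← mul_pow]; simp
    rw [traceChar_center_eq hr hl0, mul_assoc _ ((-1 : ℂ) ^ r), mul_left_comm ((-1 : ℂ) ^ r), h2]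
    rcases card_rad (m := m) hl0 with h | h | h <;> rw [h] <;> norm_num <;> ring
  rw [Finset.sum_congr rfl hG]
  simp_rw [Finset.sum_add_distrib, ← Finset.mul_sum, sum_traceChar_center]
  rw [Finset.sum_congr rfl fun l _ => sum_card_rad l]
  simp only [Finset.sum_const, nsmul_eq_mul, card_erase_zero, Finset.card_univ]
  ring

/-- At m = 0 the trace sign is 1, so for r odd `traceChar_center_eq` forces |rad| = 2. -/
theorem sum_rad_zero_of_odd (hr : Fintype.card K = 2 ^ r) (h : Odd r) (G : ℕ → ℂ) :
    ∑ l ∈ Finset.univ.erase (0 : K), G (rad l 0).card = (Fintype.card K - 1) * G 2 := by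
  have hG : ∀ l ∈ Finset.univ.erase (0 : K), G (rad l 0).card = G 2 := by
    intro l hl
    have h1 := traceChar_center_eq hr (m := 0) (Finset.ne_of_mem_erase hl)
    rw [h.neg_one_pow] at h1
    by_cases h2 : (rad l 0).card = 2
    · rw [h2]
    · rw [if_neg h2] at h1
      norm_num at h1
  rw [Finset.sum_congr rfl hG]
  simp only [Finset.sum_const, nsmul_eq_mul, card_erase_zero]

/-- At m = 0 and r even the order 2 is excluded; interpolation on {1, 4} and `sum_card_rad_zero`
give the proportions. -/
theorem sum_rad_zero_of_even (hr : Fintype.card K = 2 ^ r) (h : Even r) (G : ℕ → ℂ) :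
    ∑ l ∈ Finset.univ.erase (0 : K), G (rad l 0).card =
      (Fintype.card K - 1) * (2 / 3 * G 1 + 1 / 3 * G 4) := by
  have hG : ∀ l ∈ Finset.univ.erase (0 : K), G (rad l 0).card =
      (4 * G 1 - G 4) / 3 + (G 4 - G 1) / 3 * (rad l 0).card := by
    intro l hl
    have hl0 := Finset.ne_of_mem_erase hl
    have h1 := traceChar_center_eq hr (m := 0) hl0
    rw [h.neg_one_pow] at h1
    rcases card_rad (m := 0) hl0 with h2 | h2 | h2
    · rw [h2]; push_cast; ring
    · rw [if_pos h2] at h1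
      norm_num at h1
    · rw [h2]; push_cast; ring
  rw [Finset.sum_congr rfl hG, Finset.sum_add_distrib, ← Finset.mul_sum, sum_card_rad_zero]
  simp only [Finset.sum_const, nsmul_eq_mul, card_erase_zero]
  ring

end Counting

/-! ### Trace counts in terms of Lucas pairs -/

section Formula
open scoped Classical
variable {K L : Type*} [Field K] [Fintype K] [Field L] [Algebra K L] [FiniteDimensional K L]

theorem primePowerSum_trivial :
    primePowerSum (charPoly (K := K) 0) (Module.finrank K L) =
      (Fintype.card K : ℂ) ^ Module.finrank K L := by
  have : Finite L := Module.finite_of_finite K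
  have := Fintype.ofFinite L
  rw [← sum_ofElement (L := L)]
  simp [Module.card_eq_pow_finrank (K := K) (V := L)]

variable [CharP K 2] {r : ℕ}

theorem card_mul_traceCount_eq :
    (Fintype.card K : ℂ) ^ 3 * traceCount K L 0 0 0 =
      (Fintype.card K : ℂ) ^ Module.finrank K L +
      ∑ m ∈ Finset.univ.erase (0 : K),
        ∑ χ ∈ fiber 0 m, primePowerSum (charPoly χ) (Module.finrank K L) +
      ∑ l ∈ Finset.univ.erase (0 : K), ∑ m : K,
        ∑ χ ∈ fiber l m, primePowerSum (charPoly χ) (Module.finrank K L) := by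
  rw [card_mul_traceCount, sum_eq_sum_fiber, ← Finset.add_sum_erase _ _ (Finset.mem_univ (0 : K)),
    ← Finset.add_sum_erase _ _ (Finset.mem_univ (0 : K)),
    sum_fiber_zero_zero Module.finrank_pos, primePowerSum_trivial]

theorem traceCount_odd (hr : Fintype.card K = 2 ^ r) {k : ℕ}
    (hn : Module.finrank K L = 2 * k + 1) :
    (Fintype.card K : ℂ) ^ 3 * traceCount K L 0 0 0 = (Fintype.card K : ℂ) ^ (2 * k + 1) +
      (Fintype.card K - 1) * (Fintype.card K : ℂ) ^ (k + 1) * ((-1) ^ r) ^ ((k + 1) / 2) *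
        (1 + (Fintype.card K + 1) / 3 * (lucasPair 1 k).2 +
          Fintype.card K / 2 * ((-1) ^ ((k + 1) / 2) * (lucasPair 2 k).2) +
          (Fintype.card K - 2) / 6 * (lucasPair 4 k).2) := by
  rw [card_mul_traceCount_eq, hn, Finset.sum_congr rfl fun m hm =>
    sum_fiber_zero_odd (Finset.ne_of_mem_erase hm) k, traceChar_one hr]
  -- G is made opaque so that `sum_rad` can be rewritten with it before its values are unfolded.
  obtain ⟨G, hG⟩ : ∃ G : ℕ → ℂ, ∀ M : ℕ, G M = (Fintype.card K : ℂ) ^ (k + 1) *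
      ((if M = 2 then -1 else 1) * (-1) ^ r) ^ ((k + 1) / 2) * (lucasPair M k).2 :=
    ⟨_, fun _ => rfl⟩
  have h1 : ∀ l ∈ Finset.univ.erase (0 : K), ∑ m : K,
      ∑ χ ∈ fiber l m, primePowerSum (charPoly χ) (2 * k + 1) = ∑ m : K, G (rad l m).card := fun l hl => Finset.sum_congr rfl fun m _ => by
    have hl0 := Finset.ne_of_mem_erase hl
    rw [sum_fiber_odd hl0, traceChar_center_eq hr hl0, hG]
  rw [Finset.sum_congr rfl h1, sum_rad hr, hG, hG, hG]
  simp only [Finset.sum_const, nsmul_eq_mul, card_erase_zero]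
  norm_num [mul_pow]
  ring

theorem traceCount_four_mul (hr : Fintype.card K = 2 ^ r) {i : ℕ} (hi : 1 ≤ i)
    (hn : Module.finrank K L = 4 * i) :
    (Fintype.card K : ℂ) ^ 3 * traceCount K L 0 0 0 = (Fintype.card K : ℂ) ^ (4 * i) -
      (Fintype.card K - 1) * (Fintype.card K : ℂ) ^ (2 * i + 1) * ((-1) ^ r) ^ i *
        (1 + (Fintype.card K + 1) / 3 * (lucasPair 1 (2 * i)).1 +
          Fintype.card K / 2 * ((-1) ^ i * (2 + ((lucasPair 2 (2 * i)).1 - 2) / 2)) +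
          (Fintype.card K - 2) / 6 * (2 + ((lucasPair 4 (2 * i)).1 - 2) / 4)) := by
  rw [card_mul_traceCount_eq, hn, Finset.sum_congr rfl fun m hm =>
    sum_fiber_zero_four_mul (Finset.ne_of_mem_erase hm) hi, traceChar_one hr]
  obtain ⟨G, hG⟩ : ∃ G : ℕ → ℂ, ∀ M : ℕ, G M = -((Fintype.card K : ℂ) ^ (2 * i + 1) *
      ((if M = 2 then -1 else 1) * (-1) ^ r) ^ i * (2 + ((lucasPair M (2 * i)).1 - 2) / M)) :=
    ⟨_, fun _ => rfl⟩
  have h1 : ∀ l ∈ Finset.univ.erase (0 : K), ∑ m : K,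
      ∑ χ ∈ fiber l m, primePowerSum (charPoly χ) (4 * i) = ∑ m : K, G (rad l m).card :=
    fun l hl => Finset.sum_congr rfl fun m _ => by
      have hl0 := Finset.ne_of_mem_erase hl
      rw [sum_fiber_four_mul hl0 hi, traceChar_center_eq hr hl0, hG]
  rw [Finset.sum_congr rfl h1, sum_rad hr, hG, hG, hG]
  simp only [Finset.sum_const, nsmul_eq_mul, card_erase_zero]
  norm_num [mul_pow]
  ring

theorem traceCount_four_mul_add_two {i : ℕ} (hn : Module.finrank K L = 4 * i + 2) {G : ℕ → ℂ}
    (hG : ∀ M : ℕ, G M = -((Fintype.card K : ℂ) ^ (2 * i + 2) *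
      (-2 + ((lucasPair M (2 * i + 1)).1 + 2) / M))) :
    (Fintype.card K : ℂ) ^ 3 * traceCount K L 0 0 0 = (Fintype.card K : ℂ) ^ (4 * i + 2) +
      ∑ l ∈ Finset.univ.erase (0 : K), G (rad l 0).card := by
  rw [card_mul_traceCount_eq, hn, Finset.sum_congr rfl fun m hm =>
    sum_fiber_zero_four_mul_add_two (Finset.ne_of_mem_erase hm) i, Finset.sum_const_zero, add_zero]
  congr 1
  refine Finset.sum_congr rfl fun l hl => ?_
  rw [Finset.sum_congr rfl fun m _ =>
    sum_fiber_four_mul_add_two (Finset.ne_of_mem_erase hl) i, hG]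
  simp

theorem traceCount_four_mul_add_two_of_odd (hr : Fintype.card K = 2 ^ r) (h : Odd r) {i : ℕ}
    (hn : Module.finrank K L = 4 * i + 2) :
    (Fintype.card K : ℂ) ^ 3 * traceCount K L 0 0 0 = (Fintype.card K : ℂ) ^ (4 * i + 2) -
      (Fintype.card K - 1) * (Fintype.card K : ℂ) ^ (2 * i + 2) *
        (-2 + ((lucasPair 2 (2 * i + 1)).1 + 2) / 2) := by
  obtain ⟨G, hG⟩ : ∃ G : ℕ → ℂ, ∀ M : ℕ, G M = -((Fintype.card K : ℂ) ^ (2 * i + 2) *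
      (-2 + ((lucasPair M (2 * i + 1)).1 + 2) / M)) := ⟨_, fun _ => rfl⟩
  rw [traceCount_four_mul_add_two hn hG, sum_rad_zero_of_odd hr h]
  simp only [hG]
  push_cast
  ring

theorem traceCount_four_mul_add_two_of_even (hr : Fintype.card K = 2 ^ r) (h : Even r) {i : ℕ}
    (hn : Module.finrank K L = 4 * i + 2) :
    (Fintype.card K : ℂ) ^ 3 * traceCount K L 0 0 0 = (Fintype.card K : ℂ) ^ (4 * i + 2) -
      (Fintype.card K - 1) * (Fintype.card K : ℂ) ^ (2 * i + 2) *
        (2 / 3 * (lucasPair 1 (2 * i + 1)).1 +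
          1 / 3 * (-2 + ((lucasPair 4 (2 * i + 1)).1 + 2) / 4)) := by
  obtain ⟨G, hG⟩ : ∃ G : ℕ → ℂ, ∀ M : ℕ, G M = -((Fintype.card K : ℂ) ^ (2 * i + 2) *
      (-2 + ((lucasPair M (2 * i + 1)).1 + 2) / M)) := ⟨_, fun _ => rfl⟩
  rw [traceCount_four_mul_add_two hn hG, sum_rad_zero_of_even hr h]
  simp only [hG]
  push_cast
  ring

end Formula

/-! ### The sums of roots of unity -/

section RootsOfUnity

theorem rootU_pow_self {k : ℕ} (hk : k ≠ 0) : rootU k ^ k = 1 :=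
  (Complex.isPrimitiveRoot_exp k hk).pow_eq_one

theorem rootU_mul_pow {a b : ℕ} (ha : a ≠ 0) : rootU (a * b) ^ a = rootU b := by
  rw [rootU, rootU, ← Complex.exp_nat_mul]
  congr 1
  have : (a : ℂ) ≠ 0 := Nat.cast_ne_zero.2 ha
  push_cast
  rw [mul_div_assoc', mul_div_mul_left _ _ this]

theorem rootU_two : rootU 2 = -1 := by
  rw [rootU, ← Complex.exp_pi_mul_I]
  congr 1
  push_cast
  ring

theorem rootU_four : rootU 4 = Complex.I := by
  refine (congrArg Complex.exp ?_).trans Complex.exp_pi_div_two_mul_I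
  push_cast
  ring

theorem rootU_eight : rootU 8 = (Real.sqrt 2 : ℂ) / 2 * (1 + Complex.I) := by
  have h : rootU 8 = Complex.exp (((Real.pi / 4 : ℝ) : ℂ) * Complex.I) := by
    rw [rootU]
    congr 1
    push_cast
    ring
  rw [h, Complex.exp_mul_I, ← Complex.ofReal_cos, ← Complex.ofReal_sin, Real.cos_pi_div_four,
    Real.sin_pi_div_four]
  push_cast
  ring

theorem sqrt_two_sq : (Real.sqrt 2 : ℂ) ^ 2 = 2 := by
  rw [← Complex.ofReal_pow, Real.sq_sqrt (by norm_num)]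
  norm_num

theorem rootU_eight_sq : rootU 8 ^ 2 = Complex.I := by
  rw [rootU_eight]
  linear_combination (1 + Complex.I) ^ 2 / 4 * sqrt_two_sq + 1 / 2 * Complex.I_sq

theorem rootU_eight_sub : rootU 8 - rootU 8 * Complex.I = (Real.sqrt 2 : ℂ) := by
  rw [rootU_eight]
  linear_combination -(Real.sqrt 2 : ℂ) / 2 * Complex.I_sq

/-- The values of `ω₈ⁿ + ω₈⁷ⁿ`. -/
def octicSum (n : ℕ) : ℂ :=
  match n % 8 with
  | 0 => 2
  | 1 | 7 => Real.sqrt 2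
  | 3 | 5 => -Real.sqrt 2
  | 4 => -2
  | _ => 0

theorem octicSum_eq (n : ℕ) : rootU 8 ^ n + rootU 8 ^ (7 * n) = octicSum n := by
  have h8 := rootU_pow_self (k := 8) (by norm_num)
  have h2 := rootU_eight_sq
  have hb := rootU_eight_sub
  have hI := Complex.I_sq
  have hn := Nat.mod_lt n (show 8 > 0 by norm_num)
  rw [pow_eq_pow_mod n h8, pow_eq_pow_mod (7 * n) h8, Nat.mul_mod, octicSum]
  set u := rootU 8
  have h4 : u ^ 4 = -1 := by rw [show u ^ 4 = (u ^ 2) ^ 2 by ring, h2, hI]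
  have hb' : (Real.sqrt 2 : ℂ) = u - u ^ 3 := by rw [← hb, ← h2]; ring
  generalize n % 8 = c at hn
  interval_cases c <;> norm_num [hb']
  · linear_combination u ^ 3 * h4
  · linear_combination u ^ 2 * h4
  · linear_combination u * h4
  · linear_combination 2 * h4
  · linear_combination u * h4
  · linear_combination u ^ 2 * h4
  · linear_combination u ^ 3 * h4

/-- The values of `ω₃ⁿ + ω₃²ⁿ`. -/
def cubicSum (n : ℕ) : ℂ := if n % 3 = 0 then 2 else -1

theorem cubicSum_eq (n : ℕ) : rootU 3 ^ n + rootU 3 ^ (2 * n) = cubicSum n := by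
  have hprim : IsPrimitiveRoot (rootU 3) 3 := Complex.isPrimitiveRoot_exp 3 (by norm_num)
  have h3 := hprim.pow_eq_one
  have h1 : 1 + rootU 3 + rootU 3 ^ 2 = 0 := by
    have h : (rootU 3 - 1) * (1 + rootU 3 + rootU 3 ^ 2) = 0 := by linear_combination h3
    exact (mul_eq_zero.1 h).resolve_left (sub_ne_zero.2 (hprim.ne_one (by norm_num)))
  have hn := Nat.mod_lt n (show 3 > 0 by norm_num)
  rw [pow_eq_pow_mod n h3, mul_comm, pow_mul, pow_eq_pow_mod n h3, cubicSum]
  set w := rootU 3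
  generalize n % 3 = c at hn
  interval_cases c
  · norm_num
  · norm_num
    linear_combination h1
  · norm_num
    linear_combination h1 + w * h3

/-- The values of `iⁿ + (-i)ⁿ`. -/
def quarticSum (n : ℕ) : ℂ :=
  match n % 4 with
  | 0 => 2
  | 2 => -2
  | _ => 0

theorem quarticSum_eq (n : ℕ) : Complex.I ^ n + (-Complex.I) ^ n = quarticSum n := by
  have h4 : Complex.I ^ 4 = 1 := Complex.I_pow_four
  have h4' : (-Complex.I) ^ 4 = 1 := by rw [← h4]; ring
  have hn := Nat.mod_lt n (show 4 > 0 by norm_num)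
  rw [pow_eq_pow_mod n h4, pow_eq_pow_mod n h4', quarticSum]
  generalize n % 4 = c at hn
  interval_cases c
  · norm_num
  · norm_num
  · norm_num
  · change Complex.I ^ 3 + (-Complex.I) ^ 3 = 0
    ring

theorem octicSum_neg (n : ℕ) :
    rootU 8 ^ (3 * n) + rootU 8 ^ (5 * n) = (-1) ^ n * octicSum n := by
  have h8 := rootU_pow_self (k := 8) (by norm_num)
  have h4 : rootU 8 ^ 4 = -1 := by
    rw [show rootU 8 ^ 4 = (rootU 8 ^ 2) ^ 2 by ring, rootU_eight_sq, Complex.I_sq]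
  rw [← octicSum_eq, ← h4]
  have h (a : ℕ) : rootU 8 ^ (a * n) = (rootU 8 ^ n) ^ a := by rw [mul_comm, pow_mul]
  have hy : (rootU 8 ^ n) ^ 8 = 1 := by rw [← h, pow_mul, h8, one_pow]
  rw [← pow_mul, h, h, h, h]
  linear_combination -(rootU 8 ^ n) ^ 3 * hy

/-- With y = ω₂₄ⁿ all terms are powers of y modulo y²⁴ = 1. For example the octic exponents 3, 21
plus the cubic ones 8, 16 give 11, 19, 5, 13, and the sign (-1)ⁿ = y¹² shifts these to 23, 7, 17, 1.
-/
theorem sum_twentyfour (n : ℕ) :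
    rootU 24 ^ n + rootU 24 ^ (7 * n) + rootU 24 ^ (17 * n) + rootU 24 ^ (23 * n) =
        (-1) ^ n * octicSum n * cubicSum n ∧
      rootU 24 ^ (5 * n) + rootU 24 ^ (11 * n) + rootU 24 ^ (13 * n) + rootU 24 ^ (19 * n) =
        octicSum n * cubicSum n ∧
      rootU 12 ^ n + rootU 12 ^ (5 * n) + rootU 12 ^ (7 * n) + rootU 12 ^ (11 * n) =
        quarticSum n * cubicSum n ∧
      rootU 6 ^ n + rootU 6 ^ (5 * n) = (-1) ^ n * cubicSum n ∧
      rootU 6 ^ (2 * n) + rootU 6 ^ (4 * n) = cubicSum n := by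
  have h24 := rootU_pow_self (k := 24) (by norm_num)
  have e2 : rootU 12 = rootU 24 ^ 2 := (rootU_mul_pow (a := 2) (b := 12) (by norm_num)).symm
  have e3 : rootU 8 = rootU 24 ^ 3 := (rootU_mul_pow (a := 3) (b := 8) (by norm_num)).symm
  have e4 : rootU 6 = rootU 24 ^ 4 := (rootU_mul_pow (a := 4) (b := 6) (by norm_num)).symm
  have e6 : Complex.I = rootU 24 ^ 6 :=
    rootU_four.symm.trans (rootU_mul_pow (a := 6) (b := 4) (by norm_num)).symm
  have e8 : rootU 3 = rootU 24 ^ 8 := (rootU_mul_pow (a := 8) (b := 3) (by norm_num)).symm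
  have e12 : (-1 : ℂ) = rootU 24 ^ 12 :=
    rootU_two.symm.trans (rootU_mul_pow (a := 12) (b := 2) (by norm_num)).symm
  have eI : -Complex.I = rootU 24 ^ 18 := by
    rw [← neg_one_mul, e12, e6]; ring
  have h (a : ℕ) : rootU 24 ^ (a * n) = (rootU 24 ^ n) ^ a := by rw [mul_comm, pow_mul]
  have h' (a : ℕ) : (rootU 24 ^ a) ^ n = (rootU 24 ^ n) ^ a := by rw [← pow_mul, h]
  have h'' (a b : ℕ) : (rootU 24 ^ a) ^ (b * n) = (rootU 24 ^ n) ^ (a * b) := by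
    rw [← pow_mul, ← mul_assoc, h]
  have hy : (rootU 24 ^ n) ^ 24 = 1 := by rw [← h, pow_mul, h24, one_pow]
  rw [← octicSum_eq, ← cubicSum_eq, ← quarticSum_eq, eI, e2, e3, e4, e8, e12, e6]
  simp only [h'', h', h]
  generalize rootU 24 ^ n = y at hy
  refine ⟨?_, ?_, ?_, ?_, ?_⟩
  · linear_combination (-y ^ 7 - y ^ 17 - y * (y ^ 24 + 1)) * hy
  · linear_combination (-y ^ 5 - y ^ 13) * hy
  · linear_combination (-y ^ 2 - y ^ 10) * hy
  · linear_combination -y ^ 4 * hy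
  · trivial

end RootsOfUnity

/-! ### Trace counts and the tables modulo 24 -/

section Table

theorem rpow_half_sub_one {Q : ℝ} (hQ : 0 < Q) (x : ℝ) : Q ^ (x - 1) = Q * Q ^ (x - 2) := by
  rw [show x - 1 = 1 + (x - 2) by ring, Real.rpow_add hQ, Real.rpow_one]

theorem rpow_half_sub_two {Q : ℝ} (hQ : 0 < Q) (x : ℝ) : Q ^ (x - 2) = Q * Q ^ (x - 3) := by
  rw [show x - 2 = 1 + (x - 3) by ring, Real.rpow_add hQ, Real.rpow_one]

theorem rpow_sub_one_half {Q : ℝ} (hQ : 0 < Q) (x : ℝ) :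
    Q ^ ((x - 1) / 2 - 2) = √Q * Q ^ (x / 2 - 3) := by
  rw [show (x - 1) / 2 - 2 = 1 / 2 + (x / 2 - 3) by ring, Real.rpow_add hQ, Real.sqrt_eq_rpow]

theorem lucasPair_mod {R : ℤ} (hR : R = 1 ∨ R = 2 ∨ R = 4) (k : ℕ) :
    lucasPair R k = lucasPair R (k % 12) := by
  conv_lhs => rw [← Nat.div_add_mod k 12, lucasPair_add_mul_twelve hR]

theorem cube_mul_rpow {Q : ℝ} (hQ : 0 < Q) {x : ℝ} {e : ℕ} (h : x + 3 = e) :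
    Q ^ 3 * Q ^ x = Q ^ e := by
  rw [← Real.rpow_natCast Q e, ← h, Real.rpow_add hQ, mul_comm]
  norm_cast

/-- The exponent x can be negative for small n; multiplied by Q³ the identity involves only natural
exponents. -/
theorem eq_of_cube_mul {Q : ℝ} (hQ : 0 < Q) {n e : ℕ} (hn : 3 ≤ n) {F x c : ℝ} (h : x + 3 = e)
    (hF : Q ^ 3 * F = Q ^ n + c * Q ^ e) : F = Q ^ (n - 3) + c * Q ^ x := by
  refine mul_left_cancel₀ (pow_ne_zero 3 hQ.ne') ?_
  rw [hF, mul_add, ← pow_add, Nat.add_sub_cancel' hn, mul_left_comm, cube_mul_rpow hQ h]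

variable {K L : Type*} [Field K] [Fintype K]

theorem card_pos_real : (0 : ℝ) < Fintype.card K := Nat.cast_pos.2 Fintype.card_pos

variable [CharP K 2] [Field L] [Algebra K L] [FiniteDimensional K L] {r : ℕ}

theorem traceCount_real_odd (hr : Fintype.card K = 2 ^ r) {n : ℕ} (hn : Module.finrank K L = n)
    (h3 : 3 ≤ n) (h : n % 2 = 1) :
    (traceCount K L 0 0 0 : ℝ) = (Fintype.card K : ℝ) ^ (n - 3) +
      (((Fintype.card K : ℝ) - 1) * ((-1) ^ r) ^ ((n + 1) / 4) *
        (1 + ((Fintype.card K : ℝ) + 1) / 3 * (lucasPair 1 (n / 2 % 12)).2 +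
          (Fintype.card K : ℝ) / 2 * ((-1) ^ ((n + 1) / 4) * (lucasPair 2 (n / 2 % 12)).2) +
          ((Fintype.card K : ℝ) - 2) / 6 * (lucasPair 4 (n / 2 % 12)).2)) *
            (Fintype.card K : ℝ) ^ (((n : ℝ) - 1) / 2 - 2) := by
  obtain ⟨k, rfl⟩ : ∃ k, n = 2 * k + 1 := ⟨n / 2, by omega⟩
  refine eq_of_cube_mul card_pos_real (e := k + 1) h3 (by push_cast; ring) ?_
  rw [show (2 * k + 1) / 2 = k by omega, show (2 * k + 1 + 1) / 4 = (k + 1) / 2 by omega,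
    ← lucasPair_mod (Or.inl rfl), ← lucasPair_mod (Or.inr (Or.inl rfl)),
    ← lucasPair_mod (Or.inr (Or.inr rfl))]
  apply Complex.ofReal_injective
  push_cast
  rw [traceCount_odd hr hn]
  ring

theorem traceCount_real_four_mul (hr : Fintype.card K = 2 ^ r) {n : ℕ}
    (hn : Module.finrank K L = n) (h3 : 3 ≤ n) (h : n % 4 = 0) :
    (traceCount K L 0 0 0 : ℝ) = (Fintype.card K : ℝ) ^ (n - 3) +
      (-(((Fintype.card K : ℝ) - 1) * ((-1) ^ r) ^ (n / 4) *
        (1 + ((Fintype.card K : ℝ) + 1) / 3 * (lucasPair 1 (n / 2 % 12)).1 +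
          (Fintype.card K : ℝ) / 2 *
            ((-1) ^ (n / 4) * (2 + ((lucasPair 2 (n / 2 % 12)).1 - 2) / 2)) +
          ((Fintype.card K : ℝ) - 2) / 6 * (2 + ((lucasPair 4 (n / 2 % 12)).1 - 2) / 4)))) *
            (Fintype.card K : ℝ) ^ ((n : ℝ) / 2 - 2) := by
  obtain ⟨i, rfl⟩ : ∃ i, n = 4 * i := ⟨n / 4, by omega⟩
  refine eq_of_cube_mul card_pos_real (e := 2 * i + 1) h3 (by push_cast; ring) ?_
  rw [show 4 * i / 2 = 2 * i by omega, show 4 * i / 4 = i by omega,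
    ← lucasPair_mod (Or.inl rfl), ← lucasPair_mod (Or.inr (Or.inl rfl)),
    ← lucasPair_mod (Or.inr (Or.inr rfl))]
  apply Complex.ofReal_injective
  push_cast
  rw [traceCount_four_mul hr (by omega) hn]
  ring

theorem traceCount_real_two_mul_of_odd (hr : Fintype.card K = 2 ^ r) (hodd : Odd r) {n : ℕ}
    (hn : Module.finrank K L = n) (h3 : 3 ≤ n) (h : n % 4 = 2) :
    (traceCount K L 0 0 0 : ℝ) = (Fintype.card K : ℝ) ^ (n - 3) +
      (-(((Fintype.card K : ℝ) - 1) * (-2 + ((lucasPair 2 (n / 2 % 12)).1 + 2) / 2))) *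
        (Fintype.card K : ℝ) ^ ((n : ℝ) / 2 - 2) := by
  obtain ⟨i, rfl⟩ : ∃ i, n = 4 * i + 2 := ⟨n / 4, by omega⟩
  refine eq_of_cube_mul card_pos_real (e := 2 * i + 2) h3 (by push_cast; ring) ?_
  rw [show (4 * i + 2) / 2 = 2 * i + 1 by omega, ← lucasPair_mod (Or.inr (Or.inl rfl))]
  apply Complex.ofReal_injective
  push_cast
  rw [traceCount_four_mul_add_two_of_odd hr hodd hn]
  ring

theorem traceCount_real_two_mul_of_even (hr : Fintype.card K = 2 ^ r) (heven : Even r) {n : ℕ}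
    (hn : Module.finrank K L = n) (h3 : 3 ≤ n) (h : n % 4 = 2) :
    (traceCount K L 0 0 0 : ℝ) = (Fintype.card K : ℝ) ^ (n - 3) +
      (-(((Fintype.card K : ℝ) - 1) * (2 / 3 * (lucasPair 1 (n / 2 % 12)).1 +
          1 / 3 * (-2 + ((lucasPair 4 (n / 2 % 12)).1 + 2) / 4)))) *
        (Fintype.card K : ℝ) ^ ((n : ℝ) / 2 - 2) := by
  obtain ⟨i, rfl⟩ : ∃ i, n = 4 * i + 2 := ⟨n / 4, by omega⟩
  refine eq_of_cube_mul card_pos_real (e := 2 * i + 2) h3 (by push_cast; ring) ?_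
  rw [show (4 * i + 2) / 2 = 2 * i + 1 by omega, ← lucasPair_mod (Or.inl rfl),
    ← lucasPair_mod (Or.inr (Or.inr rfl))]
  apply Complex.ofReal_injective
  push_cast
  rw [traceCount_four_mul_add_two_of_even hr heven hn]
  ring

theorem traceCount_eq_tableOdd (hr : Fintype.card K = 2 ^ r) (hodd : Odd r) {n : ℕ}
    (hn : Module.finrank K L = n) (h3 : 3 ≤ n) :
    (traceCount K L 0 0 0 : ℝ) = (Fintype.card K : ℝ) ^ (n - 3) + tableOdd (Fintype.card K) n := by
  have hlt := Nat.mod_lt n (show 24 > 0 by norm_num)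
  have hp := rpow_half_sub_one (card_pos_real (K := K)) ((n : ℝ) / 2)
  have ho := fun h => traceCount_real_odd hr hn h3 h
  have h4 := fun h => traceCount_real_four_mul hr hn h3 h
  have h2 := fun h => traceCount_real_two_mul_of_odd hr hodd hn h3 h
  rw [tableOdd, hp]
  rw [hodd.neg_one_pow, neg_one_pow_eq_pow_mod_two (R := ℝ) (_)] at ho h4
  obtain ⟨c, hc⟩ : ∃ c, n % 24 = c := ⟨_, rfl⟩
  rw [hc] at hlt
  -- Besides the powers of q, only n/2 modulo 12 and the parities of n/4 and (n+1)/4 matter, and all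
  -- are functions of n modulo 24.
  have hk : n / 2 % 12 = c / 2 := by omega
  have ho' : (n + 1) / 4 % 2 = (c + 1) / 4 % 2 := by omega
  have h4' : n / 4 % 2 = c / 4 % 2 := by omega
  rw [ho', hk] at ho
  rw [h4', hk] at h4
  rw [hk] at h2
  rw [hc]
  interval_cases c <;> first | rw [ho (by omega)] | rw [h4 (by omega)] | rw [h2 (by omega)]
  all_goals
    simp only [lucasPair, Nat.reduceDiv, Nat.reduceMod, Nat.reduceAdd, Int.reduceMul, Int.reduceSub,
      Int.reduceNeg, one_mul]
    push_cast
    ring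

theorem traceCount_eq_tableEven (hr : Fintype.card K = 2 ^ r) (heven : Even r) {n : ℕ}
    (hn : Module.finrank K L = n) (h3 : 3 ≤ n) :
    (traceCount K L 0 0 0 : ℝ) = (Fintype.card K : ℝ) ^ (n - 3) + tableEven (Fintype.card K) n := by
  have hlt := Nat.mod_lt n (show 24 > 0 by norm_num)
  have hp := rpow_half_sub_one (card_pos_real (K := K)) ((n : ℝ) / 2)
  have ho := fun h => traceCount_real_odd hr hn h3 h
  have h4 := fun h => traceCount_real_four_mul hr hn h3 h
  have h2 := fun h => traceCount_real_two_mul_of_even hr heven hn h3 h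
  rw [tableEven, hp]
  rw [heven.neg_one_pow, one_pow, mul_one, neg_one_pow_eq_pow_mod_two (R := ℝ) (_)] at ho h4
  obtain ⟨c, hc⟩ : ∃ c, n % 24 = c := ⟨_, rfl⟩
  rw [hc] at hlt
  have hk : n / 2 % 12 = c / 2 := by omega
  have ho' : (n + 1) / 4 % 2 = (c + 1) / 4 % 2 := by omega
  have h4' : n / 4 % 2 = c / 4 % 2 := by omega
  rw [ho', hk] at ho
  rw [h4', hk] at h4
  rw [hk] at h2
  rw [hc]
  interval_cases c <;> first | rw [ho (by omega)] | rw [h4 (by omega)] | rw [h2 (by omega)]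
  all_goals
    simp only [lucasPair, Nat.reduceDiv, Nat.reduceMod, Nat.reduceAdd, Int.reduceMul, Int.reduceSub,
      Int.reduceNeg, one_mul]
    push_cast
    ring

end Table

/-! ### The Fourier combinations and the tables -/

section FourierTable

theorem complex_sqrt_sq {x : ℝ} (hx : 0 ≤ x) : (√x : ℂ) ^ 2 = x := by
  rw [← Complex.ofReal_pow, Real.sq_sqrt hx]

/-- For n odd only the part odd in √(2q) survives; its factor √2 meets that of the octic sum,
leaving √q. -/
theorem fourierOdd_eq_of_odd {q n : ℕ} (h : n % 2 = 1) {u : ℂ} (hu : octicSum n = u * √2) :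
    fourierOdd q n = ((q : ℂ) ^ 2 - 1) * (√(q : ℝ) : ℂ) * u * (cubicSum n - 2) / 3 := by
  have hn : (-1 : ℂ) ^ n = -1 := (Nat.odd_iff.2 h).neg_one_pow
  have h4 : quarticSum n = 0 := by
    have : n % 4 = 1 ∨ n % 4 = 3 := by omega
    rcases this with h | h <;> simp [quarticSum, h]
  have hb := sqrt_two_sq
  obtain ⟨h1, h2, -⟩ := sum_twentyfour n
  rw [fourierOdd]
  simp only [h1, h2, octicSum_eq, octicSum_neg, quarticSum_eq, hn, h4, hu, one_pow,
    Real.sqrt_mul (show (0 : ℝ) ≤ 2 by norm_num), Complex.ofReal_mul]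
  linear_combination ((q : ℂ) ^ 2 - 1) * (√(q : ℝ) : ℂ) * u * (cubicSum n - 2) / 6 * hb

/-- For n even the terms odd in √(2q) cancel in pairs, and its square contributes 2q. -/
theorem fourierOdd_eq_of_even {q n : ℕ} (h : n % 2 = 0) :
    fourierOdd q n = (q : ℂ) * (q - 1) * (q - 2) / 4 +
      (q : ℂ) * (q - 1) * (q + 2) / 8 * quarticSum n +
      (q : ℂ) * (q - 1) * (q + 1) / 6 * (octicSum n * cubicSum n) +
      (q : ℂ) * (q - 1) * (5 * q + 2) / 12 * octicSum n := by
  have hn : (-1 : ℂ) ^ n = 1 := (Nat.even_iff.2 h).neg_one_pow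
  have hs := complex_sqrt_sq (x := 2 * (q : ℝ)) (by positivity)
  push_cast at hs
  obtain ⟨h1, h2, -⟩ := sum_twentyfour n
  rw [fourierOdd]
  simp only [h1, h2, octicSum_eq, octicSum_neg, quarticSum_eq, hn, one_pow]
  linear_combination -((q : ℂ) - 1) * octicSum n / 12 * hs

theorem rpow_mul_fourierOdd {q : ℕ} (hq : 0 < q) (n : ℕ) :
    (((q : ℝ) ^ ((n : ℝ) / 2 - 3) : ℝ) : ℂ) * fourierOdd q n = -(tableOdd q n : ℝ) := by
  have hQ : (0 : ℝ) < q := Nat.cast_pos.2 hq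
  rw [tableOdd, rpow_half_sub_one hQ, rpow_half_sub_two hQ, rpow_sub_one_half hQ]
  have ho := fun h u hu => fourierOdd_eq_of_odd (q := q) (n := n) h (u := u) hu
  have he := fun h => fourierOdd_eq_of_even (q := q) (n := n) h
  rw [octicSum] at ho he
  rw [cubicSum] at ho he
  rw [quarticSum] at he
  have hlt := Nat.mod_lt n (show 24 > 0 by norm_num)
  obtain ⟨c, hc⟩ : ∃ c, n % 24 = c := ⟨_, rfl⟩
  rw [show n % 3 = c % 3 by omega, show n % 8 = c % 8 by omega] at ho he
  rw [show n % 4 = c % 4 by omega] at he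
  rw [hc] at hlt ⊢
  interval_cases c <;> first
    | rw [he (by omega)]
    | rw [ho (by omega) 1 (one_mul _).symm]
    | rw [ho (by omega) (-1) (neg_one_mul _).symm]
  all_goals first
    | norm_num; done
    | norm_num; ring1
    | simp only [Nat.reduceMod]; push_cast; ring1

theorem rpow_mul_fourierEven {q : ℕ} (hq : 0 < q) (n : ℕ) :
    (((q : ℝ) ^ ((n : ℝ) / 2 - 3) : ℝ) : ℂ) * fourierEven q n = -(tableEven q n : ℝ) := by
  have hQ : (0 : ℝ) < q := Nat.cast_pos.2 hq
  -- With q replaced by the square of √q, each residue class becomes a polynomial identity in √q.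
  have hs : (q : ℂ) = (√(q : ℝ) : ℂ) ^ 2 := by rw [complex_sqrt_sq hQ.le]; simp
  rw [tableEven, rpow_half_sub_one hQ, rpow_half_sub_two hQ, rpow_sub_one_half hQ]
  obtain ⟨-, -, h3, h4, h5⟩ := sum_twentyfour n
  have hF : fourierEven q n = ((q : ℂ) - 1) * (q - 2 * √(q : ℝ)) * (5 * q + 2 * √(q : ℝ) + 4) / 24
      + ((q : ℂ) - 1) * (q + 2 * √(q : ℝ)) * (5 * q - 2 * √(q : ℝ) + 4) / 24 * (-1) ^ n
      + (q : ℂ) * (q - 1) * (5 * q + 4) / 24 * quarticSum n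
      + (q : ℂ) ^ 2 * (q - 1) / 8 * (octicSum n + (-1) ^ n * octicSum n)
      + (q : ℂ) * (q - 1) ^ 2 / 12 * (quarticSum n * cubicSum n)
      + ((q : ℂ) - 1) * (q - √(q : ℝ)) * (q - √(q : ℝ) + 2) / 12 * ((-1) ^ n * cubicSum n)
      + ((q : ℂ) - 1) * (q + √(q : ℝ)) * (q + √(q : ℝ) + 2) / 12 * cubicSum n := by
    rw [fourierEven, ← octicSum_neg, ← octicSum_eq]
    simp only [h3, h4, h5, quarticSum_eq]
    ring
  rw [hF, octicSum, cubicSum, quarticSum, neg_one_pow_eq_pow_mod_two]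
  have hlt := Nat.mod_lt n (show 24 > 0 by norm_num)
  obtain ⟨c, hc⟩ : ∃ c, n % 24 = c := ⟨_, rfl⟩
  rw [show n % 3 = c % 3 by omega, show n % 8 = c % 8 by omega, show n % 4 = c % 4 by omega,
    show n % 2 = c % 2 by omega]
  rw [hc] at hlt ⊢
  interval_cases c
  all_goals first
    | norm_num; rw [hs]; ring1
    | simp only [Nat.reduceMod]; push_cast; rw [hs]; ring1

theorem table_add_twentyfour {Q : ℝ} (hQ : 0 < Q) (x y : ℝ) :
    Q ^ (x + 12 - y) = Q ^ (x - y) * Q ^ (12 : ℝ) := by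
  rw [← Real.rpow_add hQ]
  ring_nf

theorem tableOdd_add_twentyfour {q : ℕ} (hq : 0 < q) (n : ℕ) :
    tableOdd q (n + 24) = tableOdd q n * (q : ℝ) ^ (12 : ℝ) := by
  have hQ : (0 : ℝ) < q := Nat.cast_pos.2 hq
  rw [tableOdd, tableOdd, Nat.add_mod_right]
  push_cast
  rw [show ((n : ℝ) + 24) / 2 = n / 2 + 12 by ring,
    show ((n : ℝ) + 24 - 1) / 2 = (n - 1) / 2 + 12 by ring]
  simp only [table_add_twentyfour hQ]
  split <;> ring

theorem tableEven_add_twentyfour {q : ℕ} (hq : 0 < q) (n : ℕ) :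
    tableEven q (n + 24) = tableEven q n * (q : ℝ) ^ (12 : ℝ) := by
  have hQ : (0 : ℝ) < q := Nat.cast_pos.2 hq
  rw [tableEven, tableEven, Nat.add_mod_right]
  push_cast
  rw [show ((n : ℝ) + 24) / 2 = n / 2 + 12 by ring,
    show ((n : ℝ) + 24 - 1) / 2 = (n - 1) / 2 + 12 by ring]
  simp only [table_add_twentyfour hQ]
  split <;> ring

end FourierTable

end TruncUnit

end

/-! ### Assembly of the theorem -/

theorem mainTheorem1 (r q : ℕ) (hr : 1 ≤ r) (hq : q = 2 ^ r)
    (K : Type*) [Field K] [Finite K] (hK : Nat.card K = q) :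
    (∀ n : ℕ, 3 ≤ n → ∀ (L : Type*) [Field L] [Algebra K L], Module.finrank K L = n →
      (Odd r →
        (traceCount K L 0 0 0 : ℂ) =
            (q : ℂ) ^ (n - 3) - (((q : ℝ) ^ ((n : ℝ) / 2 - 3) : ℝ) : ℂ) * fourierOdd q n ∧
        (traceCount K L 0 0 0 : ℝ) = (q : ℝ) ^ (n - 3) + tableOdd q n) ∧
      (Even r →
        (traceCount K L 0 0 0 : ℂ) =
            (q : ℂ) ^ (n - 3) - (((q : ℝ) ^ ((n : ℝ) / 2 - 3) : ℝ) : ℂ) * fourierEven q n ∧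
        (traceCount K L 0 0 0 : ℝ) = (q : ℝ) ^ (n - 3) + tableEven q n)) ∧
    (∀ n : ℕ, 3 ≤ n → ∀ (L L' : Type*) [Field L] [Algebra K L] [Field L'] [Algebra K L'],
      Module.finrank K L = n → Module.finrank K L' = n + 24 →
      ((traceCount K L' 0 0 0 : ℝ) - (q : ℝ) ^ (n + 24 - 3)) / (q : ℝ) ^ (((n + 24 : ℕ) : ℝ) / 2) =
        ((traceCount K L 0 0 0 : ℝ) - (q : ℝ) ^ (n - 3)) / (q : ℝ) ^ ((n : ℝ) / 2)) := by
  have := Fintype.ofFinite K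
  rw [Nat.card_eq_fintype_card] at hK
  have hcard : Fintype.card K = 2 ^ r := hK.trans hq
  have : CharP K 2 := by
    have : Fact (Nat.Prime 2) := ⟨Nat.prime_two⟩
    exact charP_of_card_eq_prime_pow (f := r) hcard
  have hq0 : 0 < q := by rw [hq]; positivity
  have hQ : (0 : ℝ) < q := Nat.cast_pos.2 hq0
  refine ⟨fun n hn L _ _ hL => ⟨fun hodd => ?_, fun heven => ?_⟩, fun n hn L L' _ _ _ _ hL hL' => ?_⟩
  -- `Module.finrank` is 0 for infinite extensions, so n ≥ 3 forces L to be finite over K.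
  · have : FiniteDimensional K L := FiniteDimensional.of_finrank_pos (by omega)
    have h := TruncUnit.traceCount_eq_tableOdd hcard hodd hL hn
    rw [hK] at h
    refine ⟨?_, h⟩
    rw [TruncUnit.rpow_mul_fourierOdd hq0, sub_neg_eq_add]
    exact_mod_cast congrArg Complex.ofReal h
  · have : FiniteDimensional K L := FiniteDimensional.of_finrank_pos (by omega)
    have h := TruncUnit.traceCount_eq_tableEven hcard heven hL hn
    rw [hK] at h
    refine ⟨?_, h⟩
    rw [TruncUnit.rpow_mul_fourierEven hq0, sub_neg_eq_add]
    exact_mod_cast congrArg Complex.ofReal h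
  · have : FiniteDimensional K L := FiniteDimensional.of_finrank_pos (by omega)
    have : FiniteDimensional K L' := FiniteDimensional.of_finrank_pos (by omega)
    have hpow : (q : ℝ) ^ (((n + 24 : ℕ) : ℝ) / 2) =
        (q : ℝ) ^ ((n : ℝ) / 2) * (q : ℝ) ^ (12 : ℝ) := by
      rw [← Real.rpow_add hQ]
      push_cast
      ring_nf
    have h12 : (q : ℝ) ^ (12 : ℝ) ≠ 0 := (Real.rpow_pos_of_pos hQ _).ne'
    rcases Nat.even_or_odd r with heven | hodd
    · have h := TruncUnit.traceCount_eq_tableEven hcard heven hL hn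
      have h' := TruncUnit.traceCount_eq_tableEven hcard heven hL' (by omega)
      rw [hK] at h h'
      rw [h, h', add_sub_cancel_left, add_sub_cancel_left, hpow,
        TruncUnit.tableEven_add_twentyfour hq0, mul_div_mul_right _ _ h12]
    · have h := TruncUnit.traceCount_eq_tableOdd hcard hodd hL hn
      have h' := TruncUnit.traceCount_eq_tableOdd hcard hodd hL' (by omega)
      rw [hK] at h h'
      rw [h, h', add_sub_cancel_left, add_sub_cancel_left, hpow,
        TruncUnit.tableOdd_add_twentyfour hq0, mul_div_mul_right _ _ h12]
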